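/- An *elementary topos* is a category with finite limits in which every object $A$ has a power object $PA$ (with membership relation ${\in_A}\rightarrowtail PA\times A$). A *logical functor* is a functor that preserves finite limits and power objects (up to isomorphism). A topos is *Boolean* if the canonical morphism $b=[\mathrm{true},\mathrm{false}]:1+1\to\Omega$ is an isomorphism. Let $\mathsf{Top}$ be the category of small elementary toposes and logical functors, and $\mathsf{BoolTop}$ its full subcategory of Boolean toposes. For a topos $\mathcal T$, a *logical class* is a class $\mathcal W$ of morphisms of $\mathcal T$ that contains the isomorphisms, is closed under composition and pullbacks, contains all epimorphisms, contains with each $w=me$ ($e$ epi, $m$ mono) also its mono part $m$, and such that for monomorphisms $m:M\to B$ in $\mathcal W$ and $f:B\to A$ and any $g:A\to A'$ the inclusion $\forall_g m:\forall_g(fm)\to\forall_g f$ is in $\mathcal W$, where $\forall_g$ is the right adjoint of $g^{-1}:\mathrm{Sub}(A')\to\mathrm{Sub}(A)$. Let $\mathcal B(\mathcal T)$ be the least logical class containing $b:1+1\to\Omega$. For a logical class $\mathcal W$, let $\mathsf{Span}_{\mathcal W}(\mathcal T)$ have the objects of $\mathcal T$, and as morphisms $A\to B$ the classes $[s,f]_{\mathcal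 W}$ of spans $A\xleftarrow{s}D\xrightarrow{f}B$ modulo the equivalence relation generated by: $(s,f)\sim(s',f')$ if there is $x\in\mathcal W$ with $s'x=s$ and $f'x=f$. Composition is by pullback. Put $[s,f]^\circ=[f,s]$, let $\varphi\cap\psi$ be given by the pullback of the two spans over $A\times B$, and let $\varphi\le\psi$ mean $\varphi\cap\psi=\varphi$. A morphism $\varphi:A\to B$ is a *map* if $1_A\le\varphi^\circ\varphi$ and $\varphi\varphi^\circ\le 1_B$; $\mathsf{Map}(\mathsf{Span}_{\mathcal W}(\mathcal T))$ is the subcategory of maps. **Theorem.** $\mathsf{BoolTop}$ is a reflective subcategory of $\mathsf{Top}$. More precisely: - for every topos $\mathcal T$, $\mathrm{Bool}(\mathcal T)=\mathsf{Map}(\mathsf{Span}_{\mathcal B(\mathcal T)}(\mathcal T))$ is a Boolean topos, and the functor $\eta_{\mathcal T}:\mathcal T\to\mathrm{Bool}(\mathcal T)$ that is the identity on objects and sends $f$ to $[1,f]_{\mathcal B(\mathcal T)}$ is logical; - every logical functor $F:\mathcal T\to\mathcal T'$ satisfies $F(\mathcal B(\mathcal T))\subseteq\mathcal B(\mathcal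 T')$, and the functor $\mathrm{Bool}(F):\mathrm{Bool}(\mathcal T)\to\mathrm{Bool}(\mathcal T')$, $A\mapsto FA$, $[s,f]\mapsto[Fs,Ff]$, is logical; so $\mathrm{Bool}$ is a functor $\mathsf{Top}\to\mathsf{BoolTop}$; - the functor $\mathrm{Bool}$ is left adjoint to the full inclusion $\mathsf{BoolTop}\hookrightarrow\mathsf{Top}$, with unit $\eta$. -/

import Mathlib

open CategoryTheory CategoryTheory.Limits

universe w v u v' u' v'' u''

namespace ToposBool

/-! ### Elementary toposes and logical functors -/

section Topos

variable {C : Type u} [Category.{v} C] {D : Type u'} [Category.{v'} D]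

/-- The pair `(r, s)` is jointly monic, i.e. it is a relation from `B` to `A`. -/
def JointlyMono {R B A : C} (r : R ⟶ B) (s : R ⟶ A) : Prop :=
  ∀ ⦃Z : C⦄ (x y : Z ⟶ R), x ≫ r = y ≫ r → x ≫ s = y ≫ s → x = y

/-- `P`, with the membership relation `P ← E → A`, is a power object of `A`: every relation
`B ← R → A` is the pullback of the membership relation along `k × A` for a unique `k : B ⟶ P`.
(The pullback of `E ↣ P × A` along `k × A` is `B ×_P E`, with its evident maps to `B` and `A`.) -/
structure IsPowerObject {P E A : C} (p : E ⟶ P) (a : E ⟶ A) : Prop where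
  jointlyMono : JointlyMono p a
  existsUnique : ∀ ⦃B R : C⦄ (r : R ⟶ B) (s : R ⟶ A), JointlyMono r s →
    ∃! k : B ⟶ P, ∃ q : R ⟶ E, q ≫ a = s ∧ IsPullback q r p k

/-- An elementary topos: a category with finite limits and power objects. -/
class IsElementaryTopos (C : Type u) [Category.{v} C] : Prop extends HasFiniteLimits C where
  exists_powerObject : ∀ A : C, ∃ (P E : C) (p : E ⟶ P) (a : E ⟶ A), IsPowerObject p a

/-- A logical functor: it preserves finite limits and power objects (up to isomorphism). -/
structure IsLogical (F : C ⥤ D) : Prop where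
  preservesFiniteLimits : PreservesFiniteLimits F
  map_powerObject : ∀ ⦃P E A : C⦄ (p : E ⟶ P) (a : E ⟶ A),
    IsPowerObject p a → IsPowerObject (F.map p) (F.map a)

/-- `IsTrueFalse b` says that `b` is the canonical morphism `[true, false] : 1 + 1 ⟶ Ω`, for some
choice of the subobject classifier `true : 1 ⟶ Ω`, of the initial object `O` and of the
coproduct `S = 1 + 1`. Here `false` is the characteristic morphism of `O ⟶ 1`. -/
inductive IsTrueFalse : ∀ {X Y : C}, (X ⟶ Y) → Prop
  | mk (c : Subobject.Classifier C) {O : C} (hO : IsInitial O) (fls : c.Ω₀ ⟶ c.Ω)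
      (hfls : IsPullback (hO.to c.Ω₀) (hO.to c.Ω₀) fls c.truth)
      {S : C} (inl inr : c.Ω₀ ⟶ S) (hS : Nonempty (IsColimit (BinaryCofan.mk inl inr)))
      (b : S ⟶ c.Ω) (hl : inl ≫ b = c.truth) (hr : inr ≫ b = fls) : IsTrueFalse b

/-- A Boolean topos: an elementary topos in which `[true, false] : 1 + 1 ⟶ Ω` is invertible. -/
class IsBooleanTopos (C : Type u) [Category.{v} C] : Prop extends IsElementaryTopos C where
  exists_isIso : ∃ (S Ω : C) (b : S ⟶ Ω), IsTrueFalse b ∧ IsIso b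

lemma IsLogical.id : IsLogical (𝟭 C) where
  preservesFiniteLimits := inferInstance
  map_powerObject _ _ _ _ _ h := h

lemma IsLogical.comp {E : Type u''} [Category.{v''} E] {F : C ⥤ D} {G : D ⥤ E}
    (hF : IsLogical F) (hG : IsLogical G) : IsLogical (F ⋙ G) where
  preservesFiniteLimits :=
    haveI := hF.preservesFiniteLimits
    haveI := hG.preservesFiniteLimits
    comp_preservesFiniteLimits F G
  map_powerObject _ _ _ _ _ h := hG.map_powerObject _ _ (hF.map_powerObject _ _ h)

end Topos

/-! ### Logical classes of morphisms -/

section LogicalClass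

variable {C : Type u} [Category.{v} C] [HasFiniteLimits C]

/-- `T = ∀_g S`: the value at `S` of the right adjoint of `g⁻¹ : Sub A' → Sub A`. -/
def IsForall {A A' : C} (g : A ⟶ A') (S : Subobject A) (T : Subobject A') : Prop :=
  ∀ R : Subobject A', R ≤ T ↔ (Subobject.pullback g).obj R ≤ S

/-- A logical class of morphisms: it contains the identities, is closed under composition and
pullbacks (hence contains the isomorphisms), contains the epimorphisms, contains the mono part of
each of its members, and if `m : M ↣ B` is a monomorphism in it and `f : B ↣ A` is a
monomorphism, then it contains the inclusion `∀_g m : ∀_g (f m) ↣ ∀_g f` for each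
`g : A ⟶ A'`. -/
class IsLogicalClass (W : MorphismProperty C) : Prop
    extends W.IsMultiplicative, W.IsStableUnderBaseChange where
  epi_mem : ∀ ⦃X Y : C⦄ (f : X ⟶ Y), Epi f → W f
  mono_part_mem : ∀ ⦃X I Y : C⦄ (e : X ⟶ I) (m : I ⟶ Y), Epi e → Mono m → W (e ≫ m) → W m
  forall_mem : ∀ ⦃M B A A' : C⦄ (m : M ⟶ B) (f : B ⟶ A) (g : A ⟶ A') [Mono m] [Mono f],
    W m → ∀ (S T : Subobject A'), IsForall g (Subobject.mk (m ≫ f)) S →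
      IsForall g (Subobject.mk f) T → ∀ h : S ≤ T, W (Subobject.ofLE S T h)

variable (C) in
/-- The least logical class containing `[true, false] : 1 + 1 ⟶ Ω`. -/
def boolClass : MorphismProperty C := fun _ _ f =>
  ∀ W : MorphismProperty C, IsLogicalClass W →
    (∀ ⦃S Ω : C⦄ (b : S ⟶ Ω), IsTrueFalse b → W b) → W f

instance boolClass_isLogicalClass : IsLogicalClass (boolClass C) where
  id_mem X W _ _ := W.id_mem X
  comp_mem f g hf hg W hW hb := W.comp_mem f g (hf W hW hb) (hg W hW hb)
  of_isPullback sq h W hW hb := W.of_isPullback sq (h W hW hb)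
  epi_mem _ _ f hf _ hW _ := hW.epi_mem f hf
  mono_part_mem _ _ _ e m he hm h W hW hb := hW.mono_part_mem e m he hm (h W hW hb)
  forall_mem _ _ _ _ m f g _ _ h S T hS hT hST W hW hb :=
    hW.forall_mem m f g (h W hW hb) S T hS hT hST

end LogicalClass

/-! ### Quotients of the category of spans -/

section Spans

variable {C : Type u} [Category.{v} C]

/-- Spans `A ← D → B`. -/
abbrev Sp (A B : C) := Span (⊤ : MorphismProperty C) (⊤ : MorphismProperty C) A B

/-- The span `(s, f)`. -/
abbrev Sp.mk {A B D : C} (s : D ⟶ A) (f : D ⟶ B) : Sp A B := ⟨D, s, f, trivial, trivial⟩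

/-- `(s, f) ≤_W (s', f')`: there is a morphism of spans `(s, f) ⟶ (s', f')` lying in `W`. -/
def SpanStep (W : MorphismProperty C) {A B : C} (S S' : Sp A B) : Prop :=
  ∃ x : S ⟶ S', W x.hom

/-- The objects of `Span_W(C)`, which are those of `C`. -/
def SpanCat (_W : MorphismProperty C) : Type u := C

/-- The morphisms of `Span_W(C)`: the spans, modulo the equivalence relation generated
by `≤_W`. -/
def SpanHom (W : MorphismProperty C) (A B : C) : Type (max u v) :=
  Quot (SpanStep W (A := A) (B := B))

/-- The class `[s, f]_W`. -/
def SpanHom.mk (W : MorphismProperty C) {A B : C} (S : Sp A B) : SpanHom W A B :=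
  Quot.mk _ S

/-- The class of the identity span. -/
def SpanHom.id (W : MorphismProperty C) (A : C) : SpanHom W A A :=
  SpanHom.mk W (Sp.mk (𝟙 A) (𝟙 A))

lemma SpanHom.sound {W : MorphismProperty C} {A B : C} {S T : Sp A B} (x : S.apex ⟶ T.apex)
    (hx : W x) (hl : x ≫ T.l = S.l) (hr : x ≫ T.r = S.r) : SpanHom.mk W S = SpanHom.mk W T :=
  Quot.sound ⟨Span.Hom.mk x hl hr, hx⟩

lemma iso_mem (W : MorphismProperty C) [W.IsMultiplicative] [W.IsStableUnderBaseChange]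
    {X Y : C} (x : X ⟶ Y) [IsIso x] : W x :=
  W.of_isPullback (IsPullback.of_horiz_isIso (fst := x) (snd := x) (f := 𝟙 Y) (g := 𝟙 Y)
    ⟨rfl⟩) (W.id_mem _)

variable [HasFiniteLimits C]

/-- Composition of spans by pullback. -/
noncomputable def Sp.comp {A B D : C} (S : Sp A B) (T : Sp B D) : Sp A D :=
  Sp.mk (pullback.fst S.r T.l ≫ S.l) (pullback.snd S.r T.l ≫ T.r)

/-- The reversed span. -/
def Sp.conv {A B : C} (S : Sp A B) : Sp B A := Sp.mk S.r S.l

/-- The intersection of two spans: their pullback over `A × B`. -/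
noncomputable def Sp.inf {A B : C} (S T : Sp A B) : Sp A B :=
  Sp.mk (pullback.fst (prod.lift S.l S.r) (prod.lift T.l T.r) ≫ S.l)
    (pullback.fst (prod.lift S.l S.r) (prod.lift T.l T.r) ≫ S.r)

/-- A morphism of spans. -/
abbrev Sp.homMk {A B : C} {S T : Sp A B} (x : S.apex ⟶ T.apex) (hl : x ≫ T.l = S.l)
    (hr : x ≫ T.r = S.r) : S ⟶ T := Span.Hom.mk x hl hr

lemma exists_pullback_left {X X' Y B : C} {f : X ⟶ B} {f' : X' ⟶ B} (g : Y ⟶ B) (x : X ⟶ X')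
    (hx : x ≫ f' = f) : ∃ y : pullback f g ⟶ pullback f' g,
      y ≫ pullback.fst f' g = pullback.fst f g ≫ x ∧ y ≫ pullback.snd f' g = pullback.snd f g ∧
      IsPullback (pullback.fst f g) y x (pullback.fst f' g) := by
  subst hx
  obtain ⟨y, h₁, h₂⟩ : ∃ y : pullback (x ≫ f') g ⟶ pullback f' g,
      y ≫ pullback.fst f' g = pullback.fst (x ≫ f') g ≫ x ∧
      y ≫ pullback.snd f' g = pullback.snd (x ≫ f') g :=
    ⟨pullback.lift (pullback.fst (x ≫ f') g ≫ x) (pullback.snd (x ≫ f') g)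
      (by simpa using pullback.condition), pullback.lift_fst _ _ _, pullback.lift_snd _ _ _⟩
  refine ⟨y, h₁, h₂, IsPullback.flip ?_⟩
  refine IsPullback.of_right ?_ h₁ (IsPullback.of_hasPullback f' g).flip
  rw [h₂]
  exact (IsPullback.of_hasPullback (x ≫ f') g).flip

lemma exists_pullback_right {X Y Y' B : C} (f : X ⟶ B) {g : Y ⟶ B} {g' : Y' ⟶ B} (x : Y ⟶ Y')
    (hx : x ≫ g' = g) : ∃ y : pullback f g ⟶ pullback f g',
      y ≫ pullback.fst f g' = pullback.fst f g ∧ y ≫ pullback.snd f g' = pullback.snd f g ≫ x ∧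
      IsPullback (pullback.snd f g) y x (pullback.snd f g') := by
  subst hx
  obtain ⟨y, h₁, h₂⟩ : ∃ y : pullback f (x ≫ g') ⟶ pullback f g',
      y ≫ pullback.fst f g' = pullback.fst f (x ≫ g') ∧
      y ≫ pullback.snd f g' = pullback.snd f (x ≫ g') ≫ x :=
    ⟨pullback.lift (pullback.fst f (x ≫ g')) (pullback.snd f (x ≫ g') ≫ x)
      (by simpa using pullback.condition), pullback.lift_fst _ _ _, pullback.lift_snd _ _ _⟩
  refine ⟨y, h₁, h₂, IsPullback.flip ?_⟩
  refine IsPullback.of_right ?_ h₂ (IsPullback.of_hasPullback f g')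
  rw [h₁]
  exact IsPullback.of_hasPullback f (x ≫ g')

section

variable (W : MorphismProperty C) [W.IsStableUnderBaseChange]

lemma SpanStep.comp_right {A B D : C} {S S' : Sp A B} (h : SpanStep W S S') (T : Sp B D) :
    SpanStep W (S.comp T) (S'.comp T) := by
  obtain ⟨x, hx⟩ := h
  obtain ⟨y, h₁, h₂, h₃⟩ := exists_pullback_left T.l x.hom x.hom_r
  exact ⟨Sp.homMk y (((reassoc_of% h₁) S'.l).trans (congrArg _ x.hom_l)) ((reassoc_of% h₂) T.r),
    W.of_isPullback h₃ hx⟩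

lemma SpanStep.comp_left {A B D : C} (S : Sp A B) {T T' : Sp B D} (h : SpanStep W T T') :
    SpanStep W (S.comp T) (S.comp T') := by
  obtain ⟨x, hx⟩ := h
  obtain ⟨y, h₁, h₂, h₃⟩ := exists_pullback_right S.r x.hom x.hom_l
  exact ⟨Sp.homMk y ((reassoc_of% h₁) S.l) (((reassoc_of% h₂) T'.r).trans (congrArg _ x.hom_r)),
    W.of_isPullback h₃ hx⟩

lemma Sp.hom_lift {A B : C} {S S' : Sp A B} (x : S ⟶ S') :
    x.hom ≫ prod.lift S'.l S'.r = prod.lift S.l S.r := by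
  rw [prod.comp_lift, x.hom_l, x.hom_r]

lemma SpanStep.inf_right {A B : C} {S S' : Sp A B} (h : SpanStep W S S') (T : Sp A B) :
    SpanStep W (S.inf T) (S'.inf T) := by
  obtain ⟨x, hx⟩ := h
  obtain ⟨y, h₁, h₂, h₃⟩ := exists_pullback_left (prod.lift T.l T.r) x.hom (Sp.hom_lift x)
  exact ⟨Sp.homMk y (((reassoc_of% h₁) S'.l).trans (congrArg _ x.hom_l))
    (((reassoc_of% h₁) S'.r).trans (congrArg _ x.hom_r)), W.of_isPullback h₃ hx⟩

lemma SpanStep.inf_left {A B : C} (S : Sp A B) {T T' : Sp A B} (h : SpanStep W T T') :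
    SpanStep W (S.inf T) (S.inf T') := by
  obtain ⟨x, hx⟩ := h
  obtain ⟨y, h₁, h₂, h₃⟩ := exists_pullback_right (prod.lift S.l S.r) x.hom (Sp.hom_lift x)
  exact ⟨Sp.homMk y ((reassoc_of% h₁) S.l) ((reassoc_of% h₁) S.r), W.of_isPullback h₃ hx⟩

end

variable (W : MorphismProperty C) [W.IsMultiplicative] [W.IsStableUnderBaseChange]

/-- Composition in `Span_W(C)`. -/
noncomputable def SpanHom.comp {A B D : C} (φ : SpanHom W A B) (ψ : SpanHom W B D) :
    SpanHom W A D :=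
  Quot.map₂ Sp.comp (fun S _ _ h => h.comp_left W S) (fun _ _ T h => h.comp_right W T) φ ψ

/-- The anti-involution `[s, f]° = [f, s]`. -/
def SpanHom.conv {A B : C} (φ : SpanHom W A B) : SpanHom W B A :=
  Quot.map Sp.conv (fun _ _ ⟨x, hx⟩ => ⟨Sp.homMk x.hom x.hom_r x.hom_l, hx⟩) φ

/-- The intersection of two morphisms of `Span_W(C)`. -/
noncomputable def SpanHom.inf {A B : C} (φ ψ : SpanHom W A B) : SpanHom W A B :=
  Quot.map₂ Sp.inf (fun S _ _ h => h.inf_left W S) (fun _ _ T h => h.inf_right W T) φ ψ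

lemma SpanHom.id_comp {A B : C} (φ : SpanHom W A B) :
    SpanHom.comp W (SpanHom.id W A) φ = φ := by
  induction φ using Quot.ind with | _ S
  exact SpanHom.sound (pullback.snd (𝟙 A) S.l) (iso_mem W (pullback.snd (𝟙 A) S.l))
    (pullback.condition (f := 𝟙 A) (g := S.l)).symm rfl

lemma SpanHom.comp_id {A B : C} (φ : SpanHom W A B) :
    SpanHom.comp W φ (SpanHom.id W B) = φ := by
  induction φ using Quot.ind with | _ S
  exact SpanHom.sound (pullback.fst S.r (𝟙 B)) (iso_mem W (pullback.fst S.r (𝟙 B))) rfl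
    (pullback.condition (f := S.r) (g := 𝟙 B))

lemma SpanHom.assoc {A B D E : C} (φ : SpanHom W A B) (ψ : SpanHom W B D) (χ : SpanHom W D E) :
    SpanHom.comp W (SpanHom.comp W φ ψ) χ = SpanHom.comp W φ (SpanHom.comp W ψ χ) := by
  induction φ using Quot.ind with | _ S
  induction ψ using Quot.ind with | _ T
  induction χ using Quot.ind with | _ U
  refine SpanHom.sound (S := (S.comp T).comp U) (T := S.comp (T.comp U))
    (pullbackAssoc S.r T.l T.r U.l).hom
    (iso_mem W (pullbackAssoc S.r T.l T.r U.l).hom) ?_ ?_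
  · exact (pullbackAssoc_hom_fst_assoc S.r T.l T.r U.l S.l)
  · exact (pullbackAssoc_hom_snd_snd_assoc S.r T.l T.r U.l U.r)

/-- The category `Span_W(C)`, with `[s, f] ≫ [t, g]` given by pullback. -/
noncomputable instance SpanCat.category : Category.{max u v} (SpanCat W) where
  Hom A B := SpanHom W (C := C) A B
  id A := SpanHom.id W (C := C) A
  comp φ ψ := SpanHom.comp W φ ψ
  id_comp φ := SpanHom.id_comp W φ
  comp_id φ := SpanHom.comp_id W φ
  assoc φ ψ χ := SpanHom.assoc W φ ψ χ

lemma SpanHom.conv_comp {A B D : C} (φ : SpanHom W A B) (ψ : SpanHom W B D) :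
    SpanHom.conv W (SpanHom.comp W φ ψ) =
      SpanHom.comp W (SpanHom.conv W ψ) (SpanHom.conv W φ) := by
  induction φ using Quot.ind with | _ S
  induction ψ using Quot.ind with | _ T
  exact SpanHom.sound (S := (S.comp T).conv) (T := T.conv.comp S.conv)
    (pullbackSymmetry S.r T.l).hom (iso_mem W (pullbackSymmetry S.r T.l).hom)
    (pullbackSymmetry_hom_comp_fst_assoc S.r T.l T.r)
    (pullbackSymmetry_hom_comp_snd_assoc S.r T.l S.l)

/-- The order of the allegory `Span_W(C)`: `φ ≤ ψ` if and only if `φ ∩ ψ = φ`. -/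
def SpanHom.Le {A B : C} (φ ψ : SpanHom W A B) : Prop := SpanHom.inf W φ ψ = φ

/-- The maps of the allegory `Span_W(C)`: the morphisms `φ : A ⟶ B` which are total,
`1 ≤ φ ≫ φ°`, and single-valued, `φ° ≫ φ ≤ 1`. -/
def SpanHom.IsMap {A B : C} (φ : SpanHom W A B) : Prop :=
  SpanHom.Le W (SpanHom.id W A) (SpanHom.comp W φ (SpanHom.conv W φ)) ∧
    SpanHom.Le W (SpanHom.comp W (SpanHom.conv W φ) φ) (SpanHom.id W B)

/-- The maps, as a class of morphisms of `Span_W(C)`. -/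
def maps : MorphismProperty (SpanCat W) := fun A B φ => SpanHom.IsMap W (A := (A : C)) (B := B) φ

end Spans

section Maps

variable {C : Type u} [Category.{v} C] [HasFiniteLimits C]

lemma Sp.inf_condition {A B : C} (S T : Sp A B) :
    pullback.fst (prod.lift S.l S.r) (prod.lift T.l T.r) ≫ S.l =
      pullback.snd (prod.lift S.l S.r) (prod.lift T.l T.r) ≫ T.l ∧
    pullback.fst (prod.lift S.l S.r) (prod.lift T.l T.r) ≫ S.r =
      pullback.snd (prod.lift S.l S.r) (prod.lift T.l T.r) ≫ T.r := by
  have h := pullback.condition (f := prod.lift S.l S.r) (g := prod.lift T.l T.r)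
  exact ⟨by simpa only [Category.assoc, prod.lift_fst] using congrArg (· ≫ prod.fst) h,
    by simpa only [Category.assoc, prod.lift_snd] using congrArg (· ≫ prod.snd) h⟩

/-- The second projection of the intersection. -/
noncomputable def Sp.infSnd {A B : C} (S T : Sp A B) : S.inf T ⟶ T :=
  Span.Hom.mk (pullback.snd _ _) (Sp.inf_condition S T).1.symm (Sp.inf_condition S T).2.symm

/-- The first projection of the intersection. -/
noncomputable def Sp.infFst {A B : C} (S T : Sp A B) : S.inf T ⟶ S :=
  Span.Hom.mk (pullback.fst _ _) rfl rfl

lemma Sp.exists_infLift {A B : C} {R S T : Sp A B} (x : R ⟶ S) (y : R ⟶ T) :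
    ∃ z : R ⟶ S.inf T, z ≫ S.infFst T = x ∧ z ≫ S.infSnd T = y := by
  have h : x.hom ≫ prod.lift S.l S.r = y.hom ≫ prod.lift T.l T.r := by
    rw [Sp.hom_lift, Sp.hom_lift]
  refine ⟨Span.Hom.mk (pullback.lift x.hom y.hom h)
    ((pullback.lift_fst_assoc _ _ _ _).trans x.hom_l)
    ((pullback.lift_fst_assoc _ _ _ _).trans x.hom_r), ?_, ?_⟩
  · exact Span.hom_ext (pullback.lift_fst _ _ _)
  · exact Span.hom_ext (pullback.lift_snd _ _ _)

lemma Sp.inf_hom_ext {A B : C} {R S T : Sp A B} {x y : R ⟶ S.inf T}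
    (h₁ : x ≫ S.infFst T = y ≫ S.infFst T) (h₂ : x ≫ S.infSnd T = y ≫ S.infSnd T) : x = y :=
  Span.hom_ext (pullback.hom_ext (congrArg Span.Hom.hom h₁) (congrArg Span.Hom.hom h₂))

variable (W : MorphismProperty C) [IsLogicalClass W]

lemma SpanHom.sound_split {A B : C} {S T : Sp A B} (x : S ⟶ T) (y : T ⟶ S) (h : y ≫ x = 𝟙 T) :
    SpanHom.mk W S = SpanHom.mk W T := by
  have h' : y.hom ≫ x.hom = 𝟙 T.apex := congrArg Span.Hom.hom h
  have : IsSplitEpi x.hom := ⟨⟨⟨y.hom, h'⟩⟩⟩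
  exact Quot.sound ⟨x, IsLogicalClass.epi_mem x.hom inferInstance⟩

lemma SpanHom.le_of_hom {A B : C} {S T : Sp A B} (x : S ⟶ T) :
    SpanHom.Le W (SpanHom.mk W S) (SpanHom.mk W T) := by
  obtain ⟨z, hz, -⟩ := Sp.exists_infLift (𝟙 S) x
  exact SpanHom.sound_split W (S.infFst T) z hz

lemma SpanHom.exists_of_le {A B : C} {φ ψ : SpanHom W A B} (h : SpanHom.Le W φ ψ) :
    ∃ S T : Sp A B, SpanHom.mk W S = φ ∧ SpanHom.mk W T = ψ ∧ Nonempty (S ⟶ T) := by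
  induction φ using Quot.ind with | _ S
  induction ψ using Quot.ind with | _ T
  exact ⟨S.inf T, T, h, rfl, ⟨S.infSnd T⟩⟩

lemma SpanHom.Le.trans {A B : C} {φ ψ χ : SpanHom W A B} (h : SpanHom.Le W φ ψ)
    (h' : SpanHom.Le W ψ χ) : SpanHom.Le W φ χ := by
  obtain ⟨S, T, rfl, rfl, ⟨x⟩⟩ := SpanHom.exists_of_le W h
  induction χ using Quot.ind with | _ U
  obtain ⟨r, hr₁, hr₂⟩ := Sp.exists_infLift (S.infFst (T.inf U))
    (S.infSnd (T.inf U) ≫ T.infSnd U)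
  obtain ⟨t, ht₁, ht₂⟩ := Sp.exists_infLift (S.infFst U ≫ x) (S.infSnd U)
  obtain ⟨z, hz₁, hz₂⟩ := Sp.exists_infLift (S.infFst U) t
  have key : SpanHom.mk W (S.inf (T.inf U)) = SpanHom.mk W (S.inf U) :=
    SpanHom.sound_split W r z (Sp.inf_hom_ext
      (by rw [Category.assoc, hr₁, hz₁, Category.id_comp])
      (by rw [Category.assoc, hr₂, reassoc_of% hz₂, ht₂, Category.id_comp]))
  have e : SpanHom.mk W (S.inf (T.inf U)) =
      SpanHom.inf W (SpanHom.mk W S) (SpanHom.inf W (SpanHom.mk W T) (SpanHom.mk W U)) := rfl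
  exact key.symm.trans (e.trans ((congrArg (SpanHom.inf W (SpanHom.mk W S)) h').trans h))

lemma SpanHom.comp_le_comp {A B D : C} {φ φ' : SpanHom W A B} {ψ ψ' : SpanHom W B D}
    (h : SpanHom.Le W φ φ') (h' : SpanHom.Le W ψ ψ') :
    SpanHom.Le W (SpanHom.comp W φ ψ) (SpanHom.comp W φ' ψ') := by
  obtain ⟨S, S', rfl, rfl, ⟨x⟩⟩ := SpanHom.exists_of_le W h
  obtain ⟨T, T', rfl, rfl, ⟨y⟩⟩ := SpanHom.exists_of_le W h'
  obtain ⟨p, -⟩ := SpanStep.comp_right ⊤ ⟨x, trivial⟩ T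
  obtain ⟨q, -⟩ := SpanStep.comp_left ⊤ S' ⟨y, trivial⟩
  exact SpanHom.le_of_hom W (p ≫ q)

lemma SpanHom.le_refl {A B : C} (φ : SpanHom W A B) : SpanHom.Le W φ φ := by
  induction φ using Quot.ind with | _ S
  exact SpanHom.le_of_hom W (𝟙 S)

lemma SpanHom.isMap_id (A : C) : SpanHom.IsMap W (SpanHom.id W A) := by
  have h : SpanHom.conv W (SpanHom.id W A) = SpanHom.id W A := rfl
  refine ⟨?_, ?_⟩ <;> rw [h, SpanHom.id_comp] <;> exact SpanHom.le_refl W _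

lemma SpanHom.IsMap.comp {A B D : C} {φ : SpanHom W A B} {ψ : SpanHom W B D}
    (hφ : SpanHom.IsMap W φ) (hψ : SpanHom.IsMap W ψ) :
    SpanHom.IsMap W (SpanHom.comp W φ ψ) := by
  refine ⟨?_, ?_⟩
  · refine SpanHom.Le.trans W hφ.1 ?_
    have h := SpanHom.comp_le_comp W (SpanHom.le_refl W φ)
      (SpanHom.comp_le_comp W hψ.1 (SpanHom.le_refl W (SpanHom.conv W φ)))
    rw [SpanHom.id_comp] at h
    rwa [SpanHom.conv_comp, SpanHom.assoc, ← SpanHom.assoc W ψ]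
  · refine SpanHom.Le.trans W ?_ hψ.2
    have h := SpanHom.comp_le_comp W (SpanHom.le_refl W (SpanHom.conv W ψ))
      (SpanHom.comp_le_comp W hφ.2 (SpanHom.le_refl W ψ))
    rw [SpanHom.id_comp] at h
    rwa [SpanHom.conv_comp, SpanHom.assoc, ← SpanHom.assoc W _ φ]

instance maps_isMultiplicative : (maps W).IsMultiplicative where
  id_mem A := SpanHom.isMap_id W (A : C)
  comp_mem _ _ hφ hψ := SpanHom.IsMap.comp W hφ hψ

/-- `Map(Span_W(C))`, the category of maps of the allegory `Span_W(C)`. -/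
abbrev MapSpan := WideSubcategory (maps W)

/-- The class `[1, f]` of a morphism `f` of `C`. -/
def graph {A B : C} (f : A ⟶ B) : SpanHom W A B := SpanHom.mk W (Sp.mk (𝟙 A) f)

lemma isMap_graph {A B : C} (f : A ⟶ B) : SpanHom.IsMap W (graph W f) := by
  let S : Sp A B := Sp.mk (𝟙 A) f
  refine ⟨SpanHom.le_of_hom W (S := Sp.mk (𝟙 A) (𝟙 A)) (T := S.comp S.conv)
      (Span.Hom.mk (pullback.lift (𝟙 A) (𝟙 A) rfl) ?_ ?_),
    SpanHom.le_of_hom W (S := S.conv.comp S) (T := Sp.mk (𝟙 B) (𝟙 B))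
      (Span.Hom.mk (pullback.fst (𝟙 A) (𝟙 A) ≫ f) (Category.comp_id _) ?_)⟩
  · exact (pullback.lift_fst_assoc (𝟙 A) (𝟙 A) rfl (𝟙 A)).trans (Category.comp_id _)
  · exact (pullback.lift_snd_assoc (𝟙 A) (𝟙 A) rfl (𝟙 A)).trans (Category.comp_id _)
  · have h := pullback.condition (f := 𝟙 A) (g := 𝟙 A)
    rw [Category.comp_id, Category.comp_id] at h
    exact (Category.comp_id _).trans (congrArg (· ≫ f) h)

lemma graph_comp {A B D : C} (f : A ⟶ B) (g : B ⟶ D) :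
    graph W (f ≫ g) = SpanHom.comp W (graph W f) (graph W g) := by
  have h := pullback.condition (f := f) (g := 𝟙 B)
  rw [Category.comp_id] at h
  exact (SpanHom.sound (S := (Sp.mk (𝟙 A) f).comp (Sp.mk (𝟙 B) g)) (T := Sp.mk (𝟙 A) (f ≫ g))
    (pullback.fst f (𝟙 B)) (iso_mem W (pullback.fst f (𝟙 B))) rfl
    ((Category.assoc _ _ _).symm.trans (congrArg (· ≫ g) h))).symm

/-- The quotient functor `η : C ⥤ Map(Span_W(C))`, which is the identity on objects and sends
`f` to `[1, f]`. -/
noncomputable def quotientFunctor : C ⥤ MapSpan W where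
  obj A := ⟨A⟩
  map f := ⟨graph W f, isMap_graph W f⟩
  map_id _ := rfl
  map_comp f g := WideSubcategory.hom_ext _ (graph_comp W f g)

end Maps

/-! ### Functoriality -/

section Functoriality

variable {C : Type u} [Category.{v} C] {D : Type u'} [Category.{v'} D]

/-- The image of a span under a functor. -/
def Sp.map (F : C ⥤ D) {A B : C} (S : Sp A B) : Sp (F.obj A) (F.obj B) :=
  Sp.mk (F.map S.l) (F.map S.r)

/-- The image of a morphism of spans under a functor. -/
def Sp.mapHom (F : C ⥤ D) {A B : C} {S T : Sp A B} (x : S ⟶ T) : S.map F ⟶ T.map F :=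
  Span.Hom.mk (F.map x.hom) ((F.map_comp _ _).symm.trans (congrArg F.map x.hom_l))
    ((F.map_comp _ _).symm.trans (congrArg F.map x.hom_r))

/-- `[s, f]_W ↦ [F s, F f]_W'`, for a functor `F` which sends `W` into `W'`. -/
def SpanHom.map (F : C ⥤ D) {W : MorphismProperty C} {W' : MorphismProperty D}
    (hF : W ≤ W'.inverseImage F) {A B : C} (φ : SpanHom W A B) :
    SpanHom W' (F.obj A) (F.obj B) :=
  Quot.map (Sp.map F) (fun _ _ ⟨x, hx⟩ => ⟨Sp.mapHom F x, hF _ hx⟩) φ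

lemma SpanHom.map_id (F : C ⥤ D) {W : MorphismProperty C} {W' : MorphismProperty D}
    (hF : W ≤ W'.inverseImage F) (A : C) :
    SpanHom.map F hF (SpanHom.id W A) = SpanHom.id W' (F.obj A) :=
  congrArg (SpanHom.mk W') (congrArg₂ Sp.mk (F.map_id A) (F.map_id A))

lemma SpanHom.map_conv (F : C ⥤ D) {W : MorphismProperty C} {W' : MorphismProperty D}
    (hF : W ≤ W'.inverseImage F) {A B : C}
    (φ : SpanHom W A B) :
    SpanHom.map F hF (SpanHom.conv W φ) = SpanHom.conv W' (SpanHom.map F hF φ) := by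
  induction φ using Quot.ind with | _ S
  rfl

variable [HasFiniteLimits C] [HasFiniteLimits D] (F : C ⥤ D)
  {W : MorphismProperty C} {W' : MorphismProperty D} [IsLogicalClass W] [IsLogicalClass W']
  (hF : W ≤ W'.inverseImage F)

lemma SpanHom.map_le {A B : C} {φ ψ : SpanHom W A B} (h : SpanHom.Le W φ ψ) :
    SpanHom.Le W' (SpanHom.map F hF φ) (SpanHom.map F hF ψ) := by
  obtain ⟨S, T, rfl, rfl, ⟨x⟩⟩ := SpanHom.exists_of_le W h
  exact SpanHom.le_of_hom W' (Sp.mapHom F x)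

variable [PreservesFiniteLimits F]

lemma SpanHom.map_comp {A B E : C} (φ : SpanHom W A B) (ψ : SpanHom W B E) :
    SpanHom.map F hF (SpanHom.comp W φ ψ) =
      SpanHom.comp W' (SpanHom.map F hF φ) (SpanHom.map F hF ψ) := by
  induction φ using Quot.ind with | _ S
  induction ψ using Quot.ind with | _ T
  refine SpanHom.sound (S := (S.comp T).map F) (T := (S.map F).comp (T.map F))
    (PreservesPullback.iso F S.r T.l).hom (iso_mem W' (PreservesPullback.iso F S.r T.l).hom) ?_ ?_
  · exact (PreservesPullback.iso_hom_fst_assoc F S.r T.l (F.map S.l)).trans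
      (F.map_comp _ _).symm
  · exact (PreservesPullback.iso_hom_snd_assoc F S.r T.l (F.map T.r)).trans
      (F.map_comp _ _).symm

lemma SpanHom.IsMap.map {A B : C} {φ : SpanHom W A B} (h : SpanHom.IsMap W φ) :
    SpanHom.IsMap W' (SpanHom.map F hF φ) := by
  have h₁ := SpanHom.map_le F hF h.1
  have h₂ := SpanHom.map_le F hF h.2
  rw [SpanHom.map_id, SpanHom.map_comp, SpanHom.map_conv] at h₁ h₂
  exact ⟨h₁, h₂⟩

/-- The functor `Map(Span_W(C)) ⥤ Map(Span_W'(D))` induced by a functor `F : C ⥤ D` which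
preserves finite limits and sends `W` into `W'`: on objects it is `F`, and it sends `[s, f]`
to `[F s, F f]`. -/
noncomputable def mapSpanFunctor : MapSpan W ⥤ MapSpan W' where
  obj A := ⟨F.obj A.obj⟩
  map φ := ⟨SpanHom.map F hF φ.hom, SpanHom.IsMap.map F hF φ.property⟩
  map_id A := WideSubcategory.hom_ext _ (SpanHom.map_id F hF A.obj)
  map_comp φ ψ := WideSubcategory.hom_ext _ (SpanHom.map_comp F hF φ.hom ψ.hom)

end Functoriality

/-! ### The categories `Top` and `BoolTop` -/

/-- A (small) elementary topos. -/
structure Topos where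
  carrier : Type u
  [category : Category.{max w u} carrier]
  [isElementaryTopos : IsElementaryTopos carrier]

attribute [instance] Topos.category Topos.isElementaryTopos

/-- A logical functor between toposes. -/
@[ext]
structure Topos.Hom (T T' : Topos.{w, u}) where
  functor : T.carrier ⥤ T'.carrier
  isLogical : IsLogical functor

/-- The category `Top` of elementary toposes and logical functors. -/
instance Topos.instCategory : Category Topos.{w, u} where
  Hom := Topos.Hom
  id T := ⟨𝟭 T.carrier, IsLogical.id⟩
  comp F G := ⟨F.functor ⋙ G.functor, F.isLogical.comp G.isLogical⟩

instance Topos.preservesFiniteLimits {T T' : Topos.{w, u}} (F : T ⟶ T') :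
    PreservesFiniteLimits F.functor := F.isLogical.preservesFiniteLimits

/-- The property of being a Boolean topos. -/
def isBoolean : ObjectProperty Topos.{w, u} := fun T => IsBooleanTopos T.carrier

/-- The full subcategory `BoolTop` of `Top` on the Boolean toposes. -/
abbrev BoolTopos := (isBoolean.{w, u}).FullSubcategory

/-- The inclusion `BoolTop ⥤ Top`. -/
abbrev boolInclusion : BoolTopos.{w, u} ⥤ Topos.{w, u} := isBoolean.ι

/-- The underlying category `Map(Span_{B(T)}(T))` of `Bool(T)`. -/
abbrev Booleanization (T : Topos.{w, u}) := MapSpan (boolClass T.carrier)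

/-- `Bool(T)` as an object of `BoolTop`, once it is known to be a Boolean topos. -/
noncomputable def boolObj (T : Topos.{w, u}) (h : IsBooleanTopos (Booleanization T)) :
    BoolTopos.{w, u} :=
  ⟨⟨Booleanization T⟩, h⟩

/-- The quotient functor `η : T ⥤ Bool(T)` as a morphism of `Top`, once it is known to be
logical. -/
noncomputable def boolUnit (T : Topos.{w, u}) (h : IsBooleanTopos (Booleanization T))
    (hη : IsLogical (quotientFunctor (boolClass T.carrier))) :
    T ⟶ boolInclusion.obj (boolObj T h) :=
  Topos.Hom.mk (T' := (boolObj T h).obj) (quotientFunctor (boolClass T.carrier)) hη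

/-- The reflector `Bool : Top ⥤ BoolTop`, given on objects by `T ↦ Map(Span_{B(T)}(T))` and on a
logical functor `F` by `[s, f] ↦ [F s, F f]`, once it is known that these are Boolean toposes
and well-defined logical functors. -/
noncomputable def boolFunctor (hB : ∀ T : Topos.{w, u}, IsBooleanTopos (Booleanization T))
    (hW : ∀ ⦃T T' : Topos.{w, u}⦄ (F : T ⟶ T'),
      boolClass T.carrier ≤ (boolClass T'.carrier).inverseImage F.functor)
    (hL : ∀ ⦃T T' : Topos.{w, u}⦄ (F : T ⟶ T'), IsLogical (mapSpanFunctor F.functor (hW F))) :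
    Topos.{w, u} ⥤ BoolTopos.{w, u} where
  obj T := boolObj T (hB T)
  map F := ObjectProperty.homMk ⟨mapSpanFunctor F.functor (hW F), hL F⟩
  map_id T := by
    refine ObjectProperty.hom_ext _ (Topos.Hom.ext ?_)
    refine CategoryTheory.Functor.hext (fun _ => rfl) fun A B φ => heq_of_eq ?_
    refine WideSubcategory.hom_ext _ ?_
    obtain ⟨φ, hφ⟩ := φ
    induction φ using Quot.ind with | _ S
    rfl
  map_comp F G := by
    refine ObjectProperty.hom_ext _ (Topos.Hom.ext ?_)
    refine CategoryTheory.Functor.hext (fun _ => rfl) fun A B φ => heq_of_eq ?_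
    refine WideSubcategory.hom_ext _ ?_
    obtain ⟨φ, hφ⟩ := φ
    induction φ using Quot.ind with | _ S
    rfl

end ToposBool

open ToposBool

/-! Let U ↪ 1 be the truth value of ∀p (p ∨ ¬p), that is, ∀ of b : 1 + 1 ↣ Ω along Ω → 1. Over U
every truth value is decided, and Bool(T) turns out to be T seen from the objects over U, i.e. the
slice T/U up to equivalence.

The hinge is `IsBoolLocus.openClass_eq_boolClass`: a morphism lies in B(T) exactly when it becomes
epi at all stages over U. These morphisms form a logical class containing b. Conversely, U → 1
arises from b by ∀, so U × Y → Y lies in every logical class containing b; the mono part of a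
morphism that is epi over U contains this subobject, and `mem_of_liftsThru` shows that the
subobjects in a logical class are closed upwards. That closure is not an axiom and is the hard
point.

Consequently a map out of an object over U is the graph of a unique morphism of T
(`quotientFunctor_map_bijective`), and the mono U × A → A is inverted by η, so every object of
Bool(T) is isomorphic to one over U. `IsLocalQuotient` isolates these facts; finite limits, power
objects and logicality follow by moving test objects over U. Bool(T) is Boolean because the logical
functor η carries b to its counterpart and inverts it. If B is Boolean, all its objects lie over its
own U, so η_B is invertible; a logical F : T → B extends as Bool(F) followed by the inverse of η_B.
The extension is unique because every morphism of Bool(T) has the form η(f)⁻¹ η(g).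

A logical functor is only assumed to preserve finite limits and power objects. Therefore ∀ is
written as an equalizer into a power object, and epimorphisms, unions, the initial object, 1 + 1 and
U are described through ∀ and Ω; all of them are then preserved. Arguments run in generalized
elements: `LiftsThru t x` reads "x ∈ t". -/

namespace ToposBool

/-! ### Generalized elements and universal quantification along a morphism -/

section Basic

variable {C : Type u} [Category.{v} C]

/-- The morphism `x` factors through `t`: the generalized element `x` belongs to `t`. -/
def LiftsThru {T A Z : C} (t : T ⟶ A) (x : Z ⟶ A) : Prop := ∃ k : Z ⟶ T, k ≫ t = x

lemma LiftsThru.precomp {T A Z Z' : C} {t : T ⟶ A} {x : Z ⟶ A} (h : LiftsThru t x) (y : Z' ⟶ Z) :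
    LiftsThru t (y ≫ x) := by
  obtain ⟨k, rfl⟩ := h
  exact ⟨y ≫ k, Category.assoc _ _ _⟩

lemma liftsThru_self {T A : C} (t : T ⟶ A) : LiftsThru t t := ⟨𝟙 T, Category.id_comp t⟩

lemma liftsThru_comp {T A Z : C} (t : T ⟶ A) (k : Z ⟶ T) : LiftsThru t (k ≫ t) := ⟨k, rfl⟩

lemma LiftsThru.trans {T T' A Z : C} {t : T ⟶ A} {t' : T' ⟶ A} {x : Z ⟶ A}
    (h : LiftsThru t x) (h' : LiftsThru t' t) : LiftsThru t' x := by
  obtain ⟨k, rfl⟩ := h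
  exact h'.precomp k

lemma LiftsThru.map {D : Type u'} [Category.{v'} D] (F : C ⥤ D) {T A Z : C} {t : T ⟶ A}
    {x : Z ⟶ A} (h : LiftsThru t x) : LiftsThru (F.map t) (F.map x) := by
  obtain ⟨k, rfl⟩ := h
  exact ⟨F.map k, (F.map_comp _ _).symm⟩

lemma isIso_of_liftsThru_id {T A : C} (t : T ⟶ A) [Mono t] (h : LiftsThru t (𝟙 A)) :
    IsIso t := by
  obtain ⟨k, hk⟩ := h
  exact ⟨k, by rw [← cancel_mono t]; simp [hk], hk⟩

lemma liftsThru_of_isPullback {P X Y Z : C} {fst : P ⟶ X} {snd : P ⟶ Y} {f : X ⟶ Z} {g : Y ⟶ Z}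
    (h : IsPullback fst snd f g) {V : C} (x : V ⟶ X) :
    LiftsThru fst x ↔ LiftsThru g (x ≫ f) := by
  constructor
  · rintro ⟨k, rfl⟩
    exact ⟨k ≫ snd, by simp [h.w]⟩
  · rintro ⟨k, hk⟩
    exact ⟨h.lift x k hk.symm, h.lift_fst _ _ _⟩

/-- `t = ∀_g s`, in the sense of the Kripke–Joyal semantics. -/
def IsUForall {A A' S T : C} (g : A ⟶ A') (s : S ⟶ A) (t : T ⟶ A') : Prop :=
  ∀ ⦃Z : C⦄ (x : Z ⟶ A'), LiftsThru t x ↔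
    ∀ ⦃Z' : C⦄ (y : Z' ⟶ Z) (a : Z' ⟶ A), a ≫ g = y ≫ x → LiftsThru s a

lemma IsUForall.of_equiv {A A' S T T' : C} {g : A ⟶ A'} {s : S ⟶ A} {t : T ⟶ A'} {t' : T' ⟶ A'}
    (h : IsUForall g s t) (h₁ : LiftsThru t t') (h₂ : LiftsThru t' t) : IsUForall g s t' :=
  fun _ x => ⟨fun hx => (h x).1 (hx.trans h₁), fun hx => ((h x).2 hx).trans h₂⟩

/-- For x in A', k₁ names the fibre g⁻¹(x) and k₂ names its intersection with S; the fibre lies in S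
exactly when the two names agree. This uses only limits and power objects, so logical functors
preserve it. -/
lemma IsUForall.of_isPowerObject {A A' S T P E : C} [HasPullbacks C] {p : E ⟶ P} {a : E ⟶ A}
    (hP : IsPowerObject p a) {g : A ⟶ A'} {s : S ⟶ A} [Mono s] {t : T ⟶ A'} {k₁ k₂ : A' ⟶ P}
    {q₁ : A ⟶ E} {q₂ : S ⟶ E} (hq₁ : q₁ ≫ a = 𝟙 A) (hq₂ : q₂ ≫ a = s)
    (h₁ : IsPullback q₁ g p k₁) (h₂ : IsPullback q₂ (s ≫ g) p k₂) (w : t ≫ k₁ = t ≫ k₂)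
    (ht : IsLimit (Fork.ofι t w)) : IsUForall g s t := by
  intro Z x
  constructor
  · rintro ⟨k, rfl⟩ Z' y b hb
    have hw : (b ≫ q₁) ≫ p = (y ≫ k ≫ t) ≫ k₂ := by
      simp only [Category.assoc, h₁.w, ← w]
      rw [reassoc_of% hb]
    have e := h₂.lift_fst _ _ hw =≫ a
    rw [Category.assoc, hq₂, Category.assoc, hq₁, Category.comp_id] at e
    exact ⟨_, e⟩
  · intro h
    have key : x ≫ k₁ = x ≫ k₂ := by
      have hr : JointlyMono (pullback.fst x g) (pullback.snd x g) :=
        fun V b b' e e' => pullback.hom_ext e e'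
      obtain ⟨k, -, hk⟩ := hP.existsUnique _ _ hr
      obtain ⟨m, hm⟩ := h (pullback.fst x g) (pullback.snd x g) pullback.condition.symm
      have sq : IsPullback (pullback.snd x g) (pullback.fst x g) g x :=
        (IsPullback.of_hasPullback x g).flip
      -- As the fibre of x lies in S, it is also the fibre of x along s ≫ g. Hence x ≫ k₁ and x ≫ k₂
      -- name the same relation.
      have sq' : IsPullback m (pullback.fst x g) (s ≫ g) x := by
        refine ⟨⟨by rw [reassoc_of% hm, pullback.condition]⟩, ⟨PullbackCone.IsLimit.mk _
          (fun c => pullback.lift c.snd (c.fst ≫ s) (by simp [c.condition])) ?_ ?_ ?_⟩⟩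
        · intro c
          rw [← cancel_mono s, Category.assoc, hm, pullback.lift_snd]
        · intro c
          rw [pullback.lift_fst]
        · intro c l hl hl'
          apply pullback.hom_ext
          · rw [hl', pullback.lift_fst]
          · rw [pullback.lift_snd, ← hm, reassoc_of% hl]
      rw [hk (x ≫ k₁) ⟨_, ?_, sq.paste_horiz h₁.flip.flip⟩,
        hk (x ≫ k₂) ⟨_, ?_, sq'.paste_horiz h₂⟩]
      · rw [Category.assoc, hq₂, hm]
      · rw [Category.assoc, hq₁, Category.comp_id]
    exact ⟨Fork.IsLimit.lift ht x key, Fork.IsLimit.lift_ι' ht x key⟩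

section

variable [IsElementaryTopos C]

lemma exists_isUForall_data {A A' S : C} (g : A ⟶ A') (s : S ⟶ A) [Mono s] :
    ∃ (P E : C) (p : E ⟶ P) (a : E ⟶ A) (k₁ k₂ : A' ⟶ P) (q₁ : A ⟶ E) (q₂ : S ⟶ E),
      IsPowerObject p a ∧ q₁ ≫ a = 𝟙 A ∧ q₂ ≫ a = s ∧ IsPullback q₁ g p k₁ ∧
        IsPullback q₂ (s ≫ g) p k₂ := by
  obtain ⟨P, E, p, a, hP⟩ := IsElementaryTopos.exists_powerObject A
  obtain ⟨k₁, ⟨q₁, h₁, h₁'⟩, -⟩ := hP.existsUnique g (𝟙 A) (fun _ x y _ h => by simpa using h)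
  obtain ⟨k₂, ⟨q₂, h₂, h₂'⟩, -⟩ := hP.existsUnique (s ≫ g) s
    (fun _ x y _ h => by rwa [cancel_mono] at h)
  exact ⟨P, E, p, a, k₁, k₂, q₁, q₂, hP, h₁, h₂, h₁', h₂'⟩

lemma exists_isUForall {A A' S : C} (g : A ⟶ A') (s : S ⟶ A) [Mono s] :
    ∃ (T : C) (t : T ⟶ A'), Mono t ∧ IsUForall g s t := by
  obtain ⟨P, E, p, a, k₁, k₂, q₁, q₂, hP, h₁, h₂, h₁', h₂'⟩ := exists_isUForall_data g s
  exact ⟨_, equalizer.ι k₁ k₂, inferInstance, .of_isPowerObject hP h₁ h₂ h₁' h₂'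
    (equalizer.condition k₁ k₂) (equalizerIsEqualizer k₁ k₂)⟩

/-- F carries the equalizer presentation to one of the same form, and t has the same elements as
that equalizer. -/
lemma IsUForall.map {D : Type u'} [Category.{v'} D] [IsElementaryTopos D] {F : C ⥤ D}
    (hF : IsLogical F) {A A' S T : C} {g : A ⟶ A'} {s : S ⟶ A} [Mono s] {t : T ⟶ A'}
    (h : IsUForall g s t) : IsUForall (F.map g) (F.map s) (F.map t) := by
  have := hF.preservesFiniteLimits
  obtain ⟨P, E, p, a, k₁, k₂, q₁, q₂, hP, h₁, h₂, h₁', h₂'⟩ := exists_isUForall_data g s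
  have h' := IsUForall.of_isPowerObject hP h₁ h₂ h₁' h₂'
    (equalizer.condition k₁ k₂) (equalizerIsEqualizer k₁ k₂)
  have e : IsUForall (F.map g) (F.map s) (F.map (equalizer.ι k₁ k₂)) := by
    refine .of_isPowerObject (hF.map_powerObject _ _ hP) (q₁ := F.map q₁) (q₂ := F.map q₂)
      (k₁ := F.map k₁) (k₂ := F.map k₂) ?_ ?_ (h₁'.map F) ?_ ?_ ?_
    · rw [← F.map_comp, h₁, F.map_id]
    · rw [← F.map_comp, h₂]
    · rw [← F.map_comp]; exact h₂'.map F
    · rw [← F.map_comp, ← F.map_comp, equalizer.condition]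
    · exact isLimitForkMapOfIsLimit F _ (equalizerIsEqualizer k₁ k₂)
  refine e.of_equiv (LiftsThru.map F ?_) (LiftsThru.map F ?_)
  · exact (h' _).2 ((h _).1 (liftsThru_self t))
  · exact (h _).2 ((h' _).1 (liftsThru_self _))

end

end Basic

/-! ### Subobject classifiers as power objects of the terminal object -/

section PowerToClassifier

variable {C : Type u} [Category.{v} C]

/-- A power object of a terminal object, whose membership relation has terminal domain, is a
subobject classifier. -/
noncomputable def classifierOfIsPowerObject {P E A : C} {p : E ⟶ P} {a : E ⟶ A}
    (hE : IsTerminal E) (hA : IsTerminal A) (h : IsPowerObject p a) : Subobject.Classifier C :=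
  have H {U X : C} (m : U ⟶ X) [Mono m] :=
    h.existsUnique m (hA.from U) (fun _ x y e _ => by rwa [cancel_mono] at e)
  Subobject.Classifier.mkOfTerminalΩ₀ E hE P p (fun m _ => (H m).choose)
    (fun {U X} m _ => by
      obtain ⟨q, -, hq⟩ := (H m).choose_spec.1
      rw [hE.hom_ext q (hE.from U)] at hq
      exact hq.flip)
    (fun m _ χ' hχ' => (H m).choose_spec.2 χ' ⟨_, hA.hom_ext _ _, hχ'.flip⟩)

/-- Both p and a ≫ k name the full relation on E, so they are equal; as p is mono, the identity of E
then factors through the terminal object A. -/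
lemma isTerminal_of_isPowerObject {P E A : C} {p : E ⟶ P} {a : E ⟶ A} (hA : IsTerminal A)
    (h : IsPowerObject p a) : Nonempty (IsTerminal E) := by
  have hp : Mono p := ⟨fun x y e => h.jointlyMono x y e (hA.hom_ext _ _)⟩
  obtain ⟨k, ⟨q, -, hk⟩, -⟩ := h.existsUnique (𝟙 A) (𝟙 A) (fun _ x y e _ => by simpa using e)
  obtain ⟨k', -, hu⟩ := h.existsUnique (𝟙 E) a (fun _ x y e _ => by simpa using e)
  have e₁ := hu p ⟨𝟙 E, Category.id_comp a, IsKernelPair.id_of_mono p⟩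
  have e₂ := hu (a ≫ k) ⟨a ≫ q, hA.hom_ext _ _,
    IsPullback.paste_horiz (IsPullback.of_vert_isIso ⟨by simp⟩) hk⟩
  have e : a ≫ q = 𝟙 E := by
    rw [← cancel_mono p, Category.assoc, hk.w, Category.id_comp, Category.id_comp, e₁, e₂]
  exact ⟨IsTerminal.ofUniqueHom (fun X => hA.from X ≫ q) fun X m => by
    rw [← Category.comp_id m, ← e, ← Category.assoc, hA.hom_ext (m ≫ a) (hA.from X)]⟩

variable (C) in
lemma exists_classifier [IsElementaryTopos C] : Nonempty (Subobject.Classifier C) := by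
  obtain ⟨P, E, p, a, hP⟩ := IsElementaryTopos.exists_powerObject (⊤_ C)
  exact ⟨classifierOfIsPowerObject (isTerminal_of_isPowerObject terminalIsTerminal hP).some
    terminalIsTerminal hP⟩

/-- A relation to a terminal object is just a subobject. Through this, logical functors act on
classifiers. -/
lemma isPowerObject_of_classifier (c : Subobject.Classifier C) : IsPowerObject c.truth (𝟙 c.Ω₀) where
  jointlyMono _ _ _ e _ := by rwa [cancel_mono] at e
  existsUnique B R r s h := by
    have : Mono r := ⟨fun x y e => h x y e (Subsingleton.elim _ _)⟩
    refine ⟨c.χ r, ⟨c.χ₀ R, Subsingleton.elim _ _, (c.isPullback r).flip⟩, ?_⟩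
    rintro k ⟨q, -, hq⟩
    exact c.uniq r hq.flip

/-- The image of a subobject classifier under a logical functor. -/
noncomputable def mapClassifier {D : Type u'} [Category.{v'} D] {F : C ⥤ D}
    (hF : IsLogical F) (c : Subobject.Classifier C) : Subobject.Classifier D :=
  haveI := hF.preservesFiniteLimits
  have t : IsTerminal (F.obj c.Ω₀) := c.isTerminalΩ₀.isTerminalObj F c.Ω₀
  classifierOfIsPowerObject t t (hF.map_powerObject _ _ (isPowerObject_of_classifier c))

end PowerToClassifier

/-! ### Jointly covering pairs, images and epimorphisms -/

section Cover

variable {C : Type u} [Category.{v} C]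

lemma liftsThru_truth_χ (c : Subobject.Classifier C) {M X Z : C} (m : M ⟶ X) [Mono m]
    (x : Z ⟶ X) : LiftsThru c.truth (x ≫ c.χ m) ↔ LiftsThru m x :=
  (liftsThru_of_isPullback (c.isPullback m) x).symm

/-- The morphisms `l` and `r` are jointly covering: a subobject of a stage of `S` which contains
every element over `l` and every element over `r` is the whole stage. -/
def PairCover {A B S : C} (l : A ⟶ S) (r : B ⟶ S) : Prop :=
  ∀ ⦃Z E : C⦄ (s : Z ⟶ S) (e : E ⟶ Z) [Mono e],
    (∀ ⦃Z' : C⦄ (y : Z' ⟶ Z) (a : Z' ⟶ A), a ≫ l = y ≫ s → LiftsThru e y) →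
    (∀ ⦃Z' : C⦄ (y : Z' ⟶ Z) (b : Z' ⟶ B), b ≫ r = y ≫ s → LiftsThru e y) →
    LiftsThru e (𝟙 Z)

/-- Subobjects of a stage are truth values at that stage, so covering can be tested with morphisms
to Ω. -/
lemma PairCover.truth [HasPullbacks C] (c : Subobject.Classifier C) {A B S : C} {l : A ⟶ S}
    {r : B ⟶ S} (h : PairCover l r) {Z : C} (s : Z ⟶ S) (p : Z ⟶ c.Ω)
    (hl : ∀ ⦃Z' : C⦄ (y : Z' ⟶ Z) (a : Z' ⟶ A), a ≫ l = y ≫ s → LiftsThru c.truth (y ≫ p))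
    (hr : ∀ ⦃Z' : C⦄ (y : Z' ⟶ Z) (b : Z' ⟶ B), b ≫ r = y ≫ s → LiftsThru c.truth (y ≫ p)) :
    LiftsThru c.truth p := by
  have H {V : C} (y : V ⟶ Z) := liftsThru_of_isPullback (IsPullback.of_hasPullback p c.truth) y
  have := (H (𝟙 Z)).1 (h s _ (fun _ y a ha => (H y).2 (hl y a ha))
    (fun _ y b hb => (H y).2 (hr y b hb)))
  rwa [Category.id_comp] at this

lemma PairCover.of_truth (c : Subobject.Classifier C) {A B S : C} {l : A ⟶ S} {r : B ⟶ S}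
    (h : ∀ ⦃Z : C⦄ (s : Z ⟶ S) (p : Z ⟶ c.Ω),
      (∀ ⦃Z' : C⦄ (y : Z' ⟶ Z) (a : Z' ⟶ A), a ≫ l = y ≫ s → LiftsThru c.truth (y ≫ p)) →
      (∀ ⦃Z' : C⦄ (y : Z' ⟶ Z) (b : Z' ⟶ B), b ≫ r = y ≫ s → LiftsThru c.truth (y ≫ p)) →
      LiftsThru c.truth p) : PairCover l r := by
  intro Z E s e _ hl hr
  rw [← liftsThru_truth_χ c, Category.id_comp]
  exact h s (c.χ e) (fun _ y a ha => (liftsThru_truth_χ c e y).2 (hl y a ha))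
    (fun _ y b hb => (liftsThru_truth_χ c e y).2 (hr y b hb))

/-- `d` consists of the pairs `(s, p)` such that `p` holds as soon as `s` comes from `l`. -/
def IsGuard (c : Subobject.Classifier C) {A S P Q : C} (l : A ⟶ S) (π₁ : P ⟶ S) (π₂ : P ⟶ c.Ω)
    (d : Q ⟶ P) : Prop :=
  ∀ ⦃Z : C⦄ (x : Z ⟶ P), LiftsThru d x ↔
    ∀ ⦃Z' : C⦄ (y : Z' ⟶ Z) (a : Z' ⟶ A), a ≫ l = y ≫ x ≫ π₁ → LiftsThru c.truth (y ≫ x ≫ π₂)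

/-- The condition on (s, p) ranges over the fibre of l at s, so it is a ∀ along the projection from
the pullback of l, applied to the locus where p is true. -/
lemma isGuard_iff_isUForall (c : Subobject.Classifier C) {A S P Q PA V : C} {l : A ⟶ S}
    {π₁ : P ⟶ S} {π₂ : P ⟶ c.Ω} {d : Q ⟶ P} {α₁ : PA ⟶ A} {α : PA ⟶ P}
    (h : IsPullback α₁ α l π₁) {t : V ⟶ PA} {t' : V ⟶ c.Ω₀}
    (ht : IsPullback t t' (α ≫ π₂) c.truth) :
    IsGuard c l π₁ π₂ d ↔ IsUForall α t d := by
  refine forall_congr' fun Z => forall_congr' fun x => iff_congr Iff.rfl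
    (forall_congr' fun Z' => forall_congr' fun y => ⟨fun H a ha => ?_, fun H a ha => ?_⟩)
  · rw [liftsThru_of_isPullback ht, reassoc_of% ha]
    refine H (a ≫ α₁) ?_
    rw [Category.assoc, h.w, reassoc_of% ha]
  · have ha' : a ≫ l = (y ≫ x) ≫ π₁ := by rw [ha, Category.assoc]
    have := H (h.lift a (y ≫ x) ha') (h.lift_snd _ _ _)
    rwa [liftsThru_of_isPullback ht, h.lift_snd_assoc, Category.assoc] at this

section

variable [IsElementaryTopos C] (c : Subobject.Classifier C)

lemma exists_isGuard {A S P : C} (l : A ⟶ S) (π₁ : P ⟶ S) (π₂ : P ⟶ c.Ω) :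
    ∃ (Q : C) (d : Q ⟶ P), Mono d ∧ IsGuard c l π₁ π₂ d := by
  obtain ⟨Q, d, hd, h⟩ := exists_isUForall (pullback.snd l π₁)
    (pullback.fst (pullback.snd l π₁ ≫ π₂) c.truth)
  exact ⟨Q, d, hd, (isGuard_iff_isUForall c (IsPullback.of_hasPullback _ _)
    (IsPullback.of_hasPullback _ _)).2 h⟩

lemma IsGuard.map {D : Type u'} [Category.{v'} D] [IsElementaryTopos D] {F : C ⥤ D}
    (hF : IsLogical F) {c : Subobject.Classifier C} {A S P Q : C} {l : A ⟶ S} {π₁ : P ⟶ S}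
    {π₂ : P ⟶ c.Ω} {d : Q ⟶ P} (h : IsGuard c l π₁ π₂ d) :
    IsGuard (mapClassifier hF c) (F.map l) (F.map π₁) (F.map π₂) (F.map d) := by
  have := hF.preservesFiniteLimits
  rw [isGuard_iff_isUForall c (IsPullback.of_hasPullback _ _) (IsPullback.of_hasPullback _ _)] at h
  refine (isGuard_iff_isUForall (mapClassifier hF c)
    ((IsPullback.of_hasPullback l π₁).map F) (t' := F.map (pullback.snd _ _)) ?_).2 (h.map hF)
  have e := (IsPullback.of_hasPullback (pullback.snd l π₁ ≫ π₂) c.truth).map F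
  rwa [F.map_comp] at e

lemma exists_lift_map_prod {D : Type u'} [Category.{v'} D] (F : C ⥤ D) [PreservesFiniteLimits F]
    {A B : C} {Z : D} (x : Z ⟶ F.obj A) (y : Z ⟶ F.obj B) :
    ∃ z : Z ⟶ F.obj (A ⨯ B), z ≫ F.map prod.fst = x ∧ z ≫ F.map prod.snd = y := by
  let h := mapIsLimitOfPreservesOfIsLimit F prod.fst prod.snd (prodIsProd A B)
  exact ⟨BinaryFan.IsLimit.lift h x y, BinaryFan.IsLimit.lift_fst h x y,
    BinaryFan.IsLimit.lift_snd h x y⟩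

/-- Q is the universal stage at which p follows from s ∈ im l and from s ∈ im r, so the
quantification over all stages collapses to one assertion at Q, which a functor can transport. The
weak form of `hP` allows P to be the image under a functor of a product. -/
lemma pairCover_iff_of_isGuard {A B S P Q₁ Q₂ Q : C} {l : A ⟶ S} {r : B ⟶ S} {π₁ : P ⟶ S}
    {π₂ : P ⟶ c.Ω} (hP : ∀ ⦃Z : C⦄ (s : Z ⟶ S) (p : Z ⟶ c.Ω), ∃ x : Z ⟶ P, x ≫ π₁ = s ∧ x ≫ π₂ = p)
    {d₁ : Q₁ ⟶ P} {d₂ : Q₂ ⟶ P} (h₁ : IsGuard c l π₁ π₂ d₁) (h₂ : IsGuard c r π₁ π₂ d₂)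
    {q₁ : Q ⟶ Q₁} {q₂ : Q ⟶ Q₂} (hQ : IsPullback q₁ q₂ d₁ d₂) :
    PairCover l r ↔ LiftsThru c.truth (q₁ ≫ d₁ ≫ π₂) := by
  constructor
  · intro h
    refine h.truth c (q₁ ≫ d₁ ≫ π₁) _ ?_ ?_
    · have := (h₁ (q₁ ≫ d₁)).1 (liftsThru_comp _ _)
      simpa only [Category.assoc] using this
    · have := (h₂ (q₁ ≫ d₁)).1 (by rw [hQ.w]; exact liftsThru_comp _ _)
      simpa only [Category.assoc] using this
  · intro h
    refine .of_truth c fun Z s p hl hr => ?_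
    obtain ⟨x, rfl, rfl⟩ := hP s p
    obtain ⟨k₁, e₁⟩ := (h₁ x).2 hl
    obtain ⟨k₂, e₂⟩ := (h₂ x).2 hr
    have := h.precomp (hQ.lift k₁ k₂ (e₁.trans e₂.symm))
    rwa [hQ.lift_fst_assoc, reassoc_of% e₁] at this

lemma PairCover.map {D : Type u'} [Category.{v'} D] [IsElementaryTopos D] {F : C ⥤ D}
    (hF : IsLogical F) {A B S : C} {l : A ⟶ S} {r : B ⟶ S} (h : PairCover l r) :
    PairCover (F.map l) (F.map r) := by
  have := hF.preservesFiniteLimits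
  obtain ⟨c⟩ := exists_classifier C
  obtain ⟨Q₁, d₁, -, h₁⟩ := exists_isGuard c l prod.fst (prod.snd : S ⨯ c.Ω ⟶ c.Ω)
  obtain ⟨Q₂, d₂, -, h₂⟩ := exists_isGuard c r prod.fst (prod.snd : S ⨯ c.Ω ⟶ c.Ω)
  have H := (pairCover_iff_of_isGuard c
    (fun Z s p => ⟨prod.lift s p, prod.lift_fst _ _, prod.lift_snd _ _⟩) h₁ h₂
    (IsPullback.of_hasPullback d₁ d₂)).1 h
  refine (pairCover_iff_of_isGuard (mapClassifier hF c) (fun Z s p => exists_lift_map_prod F s p)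
    (h₁.map hF) (h₂.map hF) ((IsPullback.of_hasPullback d₁ d₂).map F)).2 ?_
  have e := H.map F
  rwa [F.map_comp, F.map_comp] at e

/-- The union of the images of two morphisms. -/
lemma exists_pairCover_image {A B S : C} (l : A ⟶ S) (r : B ⟶ S) :
    ∃ (I : C) (i : I ⟶ S) (l' : A ⟶ I) (r' : B ⟶ I), Mono i ∧ l' ≫ i = l ∧ r' ≫ i = r ∧
      PairCover l' r' := by
  obtain ⟨c⟩ := exists_classifier C
  obtain ⟨Q₁, d₁, -, h₁⟩ := exists_isGuard c l prod.fst (prod.snd : S ⨯ c.Ω ⟶ c.Ω)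
  obtain ⟨Q₂, d₂, -, h₂⟩ := exists_isGuard c r prod.fst (prod.snd : S ⨯ c.Ω ⟶ c.Ω)
  have hQ := IsPullback.of_hasPullback d₁ d₂
  let q := pullback.fst d₁ d₂ ≫ d₁
  -- The impredicative union: I = {s | ∀p, (s ∈ im l → p) ∧ (s ∈ im r → p) → p}.
  obtain ⟨I, i, hi, h⟩ := exists_isUForall (q ≫ prod.fst) (pullback.fst (q ≫ prod.snd) c.truth)
  have hq {Z : C} (x : Z ⟶ pullback d₁ d₂) :=
    liftsThru_of_isPullback (IsPullback.of_hasPullback (q ≫ prod.snd) c.truth) x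
  obtain ⟨l', hl'⟩ := (h l).2 fun Z y a ha => by
    rw [hq]
    have := (h₁ (a ≫ q)).1 ⟨a ≫ pullback.fst d₁ d₂, Category.assoc _ _ _⟩ (𝟙 Z) y
      (by rw [Category.assoc, ha, Category.id_comp])
    rwa [Category.id_comp, Category.assoc] at this
  obtain ⟨r', hr'⟩ := (h r).2 fun Z y a ha => by
    rw [hq]
    have := (h₂ (a ≫ q)).1 ⟨a ≫ pullback.snd d₁ d₂, by simp only [q, hQ.w, Category.assoc]⟩ (𝟙 Z) y
      (by rw [Category.assoc, ha, Category.id_comp])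
    rwa [Category.id_comp, Category.assoc] at this
  refine ⟨I, i, l', r', hi, hl', hr', .of_truth c fun Z s p H₁ H₂ => ?_⟩
  obtain ⟨k₁, e₁⟩ := (h₁ (prod.lift (s ≫ i) p)).2 fun Z' y a ha => by
    rw [prod.lift_snd]
    refine H₁ y a ?_
    rw [← cancel_mono i, Category.assoc, hl', ha, prod.lift_fst, Category.assoc]
  obtain ⟨k₂, e₂⟩ := (h₂ (prod.lift (s ≫ i) p)).2 fun Z' y a ha => by
    rw [prod.lift_snd]
    refine H₂ y a ?_
    rw [← cancel_mono i, Category.assoc, hr', ha, prod.lift_fst, Category.assoc]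
  have e : hQ.lift k₁ k₂ (e₁.trans e₂.symm) ≫ q = prod.lift (s ≫ i) p := by
    rw [hQ.lift_fst_assoc, e₁]
  have := (h (s ≫ i)).1 (liftsThru_comp _ _) (𝟙 Z) (hQ.lift k₁ k₂ (e₁.trans e₂.symm))
    (by rw [reassoc_of% e, prod.lift_fst, Category.id_comp])
  rwa [hq, reassoc_of% e, prod.lift_snd] at this

lemma PairCover.hom_ext {A B S Y : C} {l : A ⟶ S} {r : B ⟶ S} (h : PairCover l r) {x y : S ⟶ Y}
    (hl : l ≫ x = l ≫ y) (hr : r ≫ x = r ≫ y) : x = y := by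
  obtain ⟨k, hk⟩ := h (𝟙 S) (equalizer.ι x y)
    (fun Z y' a ha => by
      rw [← Category.comp_id y', ← ha]
      exact ⟨a ≫ equalizer.lift l hl, by simp⟩)
    (fun Z y' a ha => by
      rw [← Category.comp_id y', ← ha]
      exact ⟨a ≫ equalizer.lift r hr, by simp⟩)
  rw [← Category.id_comp x, ← hk, Category.assoc, equalizer.condition, reassoc_of% hk]

/-- The characteristic morphism of f agrees with the constant "true" after precomposition with the
epi f, so every element of Y belongs to f. -/
lemma isIso_of_mono_of_epi' {X Y : C} (f : X ⟶ Y) [Mono f] [Epi f] : IsIso f := by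
  obtain ⟨c⟩ := exists_classifier C
  refine isIso_of_liftsThru_id f ?_
  rw [← liftsThru_truth_χ c, Category.id_comp]
  refine ⟨c.χ₀ Y, ?_⟩
  rw [← cancel_epi f, (c.isPullback f).w, ← Category.assoc, Subsingleton.elim (f ≫ c.χ₀ Y)]

/-- The inclusion of the image of an epi is mono and epi, hence invertible. Stability of epis under
pullback and under logical functors is read off from the covering condition. -/
lemma epi_iff_pairCover {X Y : C} (f : X ⟶ Y) : Epi f ↔ PairCover f f := by
  refine ⟨fun _ => ?_, fun h => ⟨fun x y e => h.hom_ext e e⟩⟩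
  obtain ⟨I, i, l, r, _, hl, hr, h⟩ := exists_pairCover_image f f
  have : Epi i := epi_of_epi_fac hl
  have := isIso_of_mono_of_epi' i
  intro Z E s e _ h₁ h₂
  refine h (s ≫ inv i) e (fun Z' y a ha => h₁ y a ?_) (fun Z' y a ha => h₁ y a ?_)
  · rw [← hl, reassoc_of% ha, IsIso.inv_hom_id, Category.comp_id]
  · rw [← hr, reassoc_of% ha, IsIso.inv_hom_id, Category.comp_id]

lemma epi_map_of_isLogical {D : Type u'} [Category.{v'} D] [IsElementaryTopos D] {F : C ⥤ D}
    (hF : IsLogical F) {X Y : C} (f : X ⟶ Y) [Epi f] : Epi (F.map f) :=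
  (epi_iff_pairCover _).2 (((epi_iff_pairCover f).1 inferInstance).map hF)

lemma epi_of_isPullback {P X Y Z : C} {fst : P ⟶ X} {snd : P ⟶ Y} {f : X ⟶ Z} {g : Y ⟶ Z}
    (h : IsPullback fst snd f g) [Epi f] : Epi snd := by
  rw [epi_iff_pairCover]
  have hf := (epi_iff_pairCover f).1 inferInstance
  intro V E s e _ h₁ h₂
  have (V' : C) (y : V' ⟶ V) (a : V' ⟶ X) (ha : a ≫ f = y ≫ s ≫ g) : LiftsThru e y :=
    h₁ y (h.lift a (y ≫ s) (by rw [ha, Category.assoc])) (h.lift_snd _ _ _)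
  exact hf (s ≫ g) e this this

instance epi_pullback_fst {X Y Z : C} (f : X ⟶ Z) (g : Y ⟶ Z) [Epi g] : Epi (pullback.fst f g) :=
  epi_of_isPullback (IsPullback.of_hasPullback f g).flip

instance epi_pullback_snd {X Y Z : C} (f : X ⟶ Z) (g : Y ⟶ Z) [Epi f] : Epi (pullback.snd f g) :=
  epi_of_isPullback (IsPullback.of_hasPullback f g)

lemma exists_epi_mono {X Y : C} (f : X ⟶ Y) :
    ∃ (I : C) (e : X ⟶ I) (m : I ⟶ Y), Epi e ∧ Mono m ∧ e ≫ m = f := by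
  obtain ⟨I, i, l, r, hi, rfl, hr, h⟩ := exists_pairCover_image f f
  rw [cancel_mono] at hr
  subst hr
  exact ⟨I, _, i, (epi_iff_pairCover _).2 h, hi, rfl⟩

/-- A morphism descends along an epimorphism if it is compatible with its kernel pair. -/
lemma exists_desc_of_epi {X Y Q : C} (s : X ⟶ Q) [Epi s] (f : X ⟶ Y)
    (h : ∀ ⦃Z : C⦄ (d d' : Z ⟶ X), d ≫ s = d' ≫ s → d ≫ f = d' ≫ f) :
    ∃ g : Q ⟶ Y, s ≫ g = f := by
  -- The image of (s, f) in Q × Y is the graph of the morphism sought: its projection to Q is epi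
  -- because s is, and mono by compatibility with the kernel pair.
  obtain ⟨I, e, m, he, hm, hf⟩ := exists_epi_mono (prod.lift s f)
  have e₁ : e ≫ m ≫ prod.fst = s := by rw [reassoc_of% hf, prod.lift_fst]
  have e₂ : e ≫ m ≫ prod.snd = f := by rw [reassoc_of% hf, prod.lift_snd]
  have : Epi (m ≫ prod.fst) := epi_of_epi_fac e₁
  have : Mono (m ≫ (prod.fst : Q ⨯ Y ⟶ Q)) := by
    refine ⟨fun {Z} x y hxy => ?_⟩
    -- Both a and b are epi because e is; over them x and y come from elements of X, to which `h`
    -- applies.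
    let a := pullback.snd e x
    let b := pullback.snd e (a ≫ y)
    have ha : pullback.fst e x ≫ e = a ≫ x := pullback.condition
    have hb : pullback.fst e (a ≫ y) ≫ e = b ≫ a ≫ y := pullback.condition
    have H := h (b ≫ pullback.fst e x) (pullback.fst e (a ≫ y)) (by
      rw [← e₁, Category.assoc, reassoc_of% ha, hxy, reassoc_of% hb])
    rw [← cancel_epi a, ← cancel_epi b, ← cancel_mono m]
    apply prod.hom_ext
    · simp only [Category.assoc, hxy]
    · rw [← e₂, Category.assoc, reassoc_of% ha, reassoc_of% hb] at H
      simpa only [Category.assoc] using H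
  have := isIso_of_mono_of_epi' (m ≫ (prod.fst : Q ⨯ Y ⟶ Q))
  refine ⟨inv (m ≫ prod.fst) ≫ m ≫ prod.snd, ?_⟩
  rw [← e₁, Category.assoc, Category.assoc, ← Category.assoc m prod.fst, IsIso.hom_inv_id_assoc, e₂]

end

end Cover

/-! ### The initial object and disjoint coproducts -/

section Initial

variable {C : Type u} [Category.{v} C] (c : Subobject.Classifier C)

/-- Everything is true over `O`. -/
def IsAbsurd (O : C) : Prop := ∀ ⦃Z : C⦄ (_ : Z ⟶ O) (p : Z ⟶ c.Ω), LiftsThru c.truth p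

lemma disjoint_of_isPullback {O : C} {o : O ⟶ c.Ω₀}
    (hO : IsAbsurd c O) {fls : c.Ω₀ ⟶ c.Ω} (hfls : IsPullback o o fls c.truth) {S : C}
    {inl inr : c.Ω₀ ⟶ S} {b : S ⟶ c.Ω} (hl : inl ≫ b = c.truth) (hr : inr ≫ b = fls) ⦃Z : C⦄
    (x y : Z ⟶ c.Ω₀) (h : x ≫ inl = y ≫ inr) : ∃ O : C, IsAbsurd c O ∧ Nonempty (Z ⟶ O) :=
  ⟨O, hO, ⟨hfls.lift y x (by
    have := h =≫ b
    rw [Category.assoc, Category.assoc, hl, hr] at this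
    exact this.symm)⟩⟩

variable {c}

lemma IsAbsurd.liftsThru {O : C} (h : IsAbsurd c O) {Z E : C} (f : Z ⟶ O) (e : E ⟶ Z) [Mono e] :
    LiftsThru e (𝟙 Z) := by
  rw [← liftsThru_truth_χ c, Category.id_comp]
  exact h f _

variable [IsElementaryTopos C]

lemma IsAbsurd.hom_eq {O : C} (h : IsAbsurd c O) {Z Y : C} (f : Z ⟶ O) (x y : Z ⟶ Y) : x = y := by
  obtain ⟨k, hk⟩ := h.liftsThru f (equalizer.ι x y)
  rw [← Category.id_comp x, ← hk, Category.assoc, equalizer.condition, reassoc_of% hk]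

/-- The mono is the singleton map, and the morphism from O names the full relation O × Y. Only this
bare existence of morphisms into P is needed to reach Y from an absurd object. -/
lemma exists_mono_to_powerObject (Y : C) :
    ∃ (P : C) (i : Y ⟶ P), Mono i ∧ ∀ O : C, Nonempty (O ⟶ P) := by
  obtain ⟨P, E, p, a, h⟩ := IsElementaryTopos.exists_powerObject Y
  obtain ⟨i, ⟨q, hq, sq⟩, -⟩ := h.existsUnique (𝟙 Y) (𝟙 Y) (fun _ _ _ e _ => by simpa using e)
  refine ⟨P, i, ⟨fun {Z} x y e => ?_⟩, fun O => ?_⟩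
  · obtain ⟨z, hz₁, hz₂⟩ : ∃ z, z ≫ q = x ≫ q ∧ z ≫ 𝟙 Y = y :=
      ⟨_, sq.lift_fst _ _ (by rw [Category.assoc, sq.w, Category.id_comp, e]), sq.lift_snd _ _ _⟩
    have e₁ := hz₁ =≫ a
    rw [Category.assoc, Category.assoc, hq, Category.comp_id, Category.comp_id] at e₁
    rw [← e₁, ← hz₂, Category.comp_id]
  · obtain ⟨k, -⟩ := h.existsUnique (prod.fst : O ⨯ Y ⟶ O) prod.snd
      (fun _ _ _ e e' => prod.hom_ext e e')
    exact ⟨k⟩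

/-- Every subobject of O is all of O. Applied to the pullback of Y ↣ P along some O → P this gives a
morphism O → Y; applied to equalizers it gives uniqueness. -/
lemma IsAbsurd.isInitial {O : C} (h : IsAbsurd c O) : Nonempty (IsInitial O) := by
  have H (Y : C) : Nonempty (O ⟶ Y) := by
    obtain ⟨P, i, hi, hP⟩ := exists_mono_to_powerObject Y
    obtain ⟨k⟩ := hP O
    obtain ⟨m, -⟩ := h.liftsThru (𝟙 O) (pullback.fst k i)
    exact ⟨m ≫ pullback.snd k i⟩
  exact ⟨IsInitial.ofUniqueHom (fun Y => (H Y).some) fun Y m => h.hom_eq (𝟙 O) _ _⟩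

variable (c)

/-- O is the truth value of ∀p. p. -/
lemma exists_isAbsurd : ∃ O : C, IsAbsurd c O := by
  obtain ⟨O, t, -, h⟩ := exists_isUForall (c.χ₀ c.Ω) c.truth
  exact ⟨O, fun Z f p => (h (f ≫ t)).1 (liftsThru_comp _ _) (𝟙 Z) p (Subsingleton.elim _ _)⟩

lemma isAbsurd_of_isInitial {O : C} (hO : IsInitial O) : IsAbsurd c O := by
  obtain ⟨O', h⟩ := exists_isAbsurd c
  exact fun Z f p => h (f ≫ hO.to O') p

lemma mono_of_isInitial {O : C} (hO : IsInitial O) {Y : C} (f : O ⟶ Y) : Mono f :=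
  ⟨fun x _ _ => (isAbsurd_of_isInitial (exists_classifier C).some hO).hom_eq x _ _⟩

/-- Absurdity is a statement about the single universal truth value O × Ω → Ω, and F preserves that
product. -/
lemma IsAbsurd.map {D : Type u'} [Category.{v'} D] [IsElementaryTopos D] {F : C ⥤ D}
    (hF : IsLogical F) {O : C} (h : IsAbsurd c O) : IsAbsurd (mapClassifier hF c) (F.obj O) := by
  have := hF.preservesFiniteLimits
  intro Z f p
  obtain ⟨z, -, hz⟩ := exists_lift_map_prod F f (p : Z ⟶ F.obj c.Ω)
  have e := ((h prod.fst (prod.snd : O ⨯ c.Ω ⟶ c.Ω)).map F).precomp z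
  rwa [hz] at e

lemma isInitial_map {D : Type u'} [Category.{v'} D] [IsElementaryTopos D] {F : C ⥤ D}
    (hF : IsLogical F) {O : C} (hO : IsInitial O) : Nonempty (IsInitial (F.obj O)) := by
  obtain ⟨c⟩ := exists_classifier C
  exact ((isAbsurd_of_isInitial c hO).map c hF).isInitial

/-- Two monomorphisms which are disjoint and jointly covering form a coproduct. -/
lemma isColimit_of_pairCover {A B S : C} (l : A ⟶ S) (r : B ⟶ S) [Mono l] [Mono r]
    (hd : ∀ ⦃Z : C⦄ (a : Z ⟶ A) (b : Z ⟶ B), a ≫ l = b ≫ r → ∃ O : C, IsAbsurd c O ∧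
      Nonempty (Z ⟶ O)) (h : PairCover l r) : Nonempty (IsColimit (BinaryCofan.mk l r)) := by
  have H {Y : C} (f : A ⟶ Y) (g : B ⟶ Y) : ∃ x : S ⟶ Y, l ≫ x = f ∧ r ≫ x = g := by
    -- R₁ = {(s, y) | ∀a, l a = s → y = f a}, and R₂ likewise for r and g. Their intersection is the
    -- graph of the copairing.
    obtain ⟨R₁, t₁, _, h₁⟩ := exists_isUForall (prod.map l (𝟙 Y)) (prod.lift (𝟙 A) f)
    obtain ⟨R₂, t₂, _, h₂⟩ := exists_isUForall (prod.map r (𝟙 Y)) (prod.lift (𝟙 B) g)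
    have H₁ {Z Z' : C} (x : Z ⟶ S ⨯ Y) (hx : LiftsThru t₁ x) (y : Z' ⟶ Z) (a : Z' ⟶ A)
        (ha : a ≫ l = y ≫ x ≫ prod.fst) : y ≫ x ≫ prod.snd = a ≫ f := by
      obtain ⟨k, hk⟩ := (h₁ x).1 hx y (prod.lift a (y ≫ x ≫ prod.snd))
        (by rw [prod.lift_map, ha, Category.comp_id, ← prod.comp_lift, ← prod.comp_lift,
          prod.lift_fst_snd, Category.comp_id])
      have e₁ := hk =≫ prod.fst
      have e₂ := hk =≫ prod.snd
      simp only [Category.assoc, prod.lift_fst, prod.lift_snd, Category.comp_id] at e₁ e₂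
      rw [← e₂, e₁]
    have H₂ {Z Z' : C} (x : Z ⟶ S ⨯ Y) (hx : LiftsThru t₂ x) (y : Z' ⟶ Z) (a : Z' ⟶ B)
        (ha : a ≫ r = y ≫ x ≫ prod.fst) : y ≫ x ≫ prod.snd = a ≫ g := by
      obtain ⟨k, hk⟩ := (h₂ x).1 hx y (prod.lift a (y ≫ x ≫ prod.snd))
        (by rw [prod.lift_map, ha, Category.comp_id, ← prod.comp_lift, ← prod.comp_lift,
          prod.lift_fst_snd, Category.comp_id])
      have e₁ := hk =≫ prod.fst
      have e₂ := hk =≫ prod.snd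
      simp only [Category.assoc, prod.lift_fst, prod.lift_snd, Category.comp_id] at e₁ e₂
      rw [← e₂, e₁]
    let t := pullback.fst t₁ t₂ ≫ t₁
    have ht : t = pullback.snd t₁ t₂ ≫ t₂ := pullback.condition
    have ht₁ {Z : C} (k : Z ⟶ pullback t₁ t₂) : LiftsThru t₁ (k ≫ t) :=
      ⟨k ≫ pullback.fst _ _, Category.assoc _ _ _⟩
    have ht₂ {Z : C} (k : Z ⟶ pullback t₁ t₂) : LiftsThru t₂ (k ≫ t) :=
      ⟨k ≫ pullback.snd _ _, by rw [ht, Category.assoc]⟩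
    -- Two values at the same s agree wherever s comes from l or from r, and these cover.
    have hmono : Mono (t ≫ prod.fst) := by
      refine ⟨fun {Z} x y e => ?_⟩
      have : x ≫ t = y ≫ t := by
        apply prod.hom_ext
        · simpa only [Category.assoc] using e
        · obtain ⟨k, hk⟩ := h (x ≫ t ≫ prod.fst)
            (equalizer.ι ((x ≫ t) ≫ prod.snd) ((y ≫ t) ≫ prod.snd))
            (fun Z' z a ha => ⟨equalizer.lift z (by
              rw [H₁ _ (ht₁ x) z a (by simp only [ha, Category.assoc]),
                H₁ _ (ht₁ y) z a (by simp only [ha, e, Category.assoc])]), equalizer.lift_ι _ _⟩)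
            (fun Z' z a ha => ⟨equalizer.lift z (by
              rw [H₂ _ (ht₂ x) z a (by simp only [ha, Category.assoc]),
                H₂ _ (ht₂ y) z a (by simp only [ha, e, Category.assoc])]), equalizer.lift_ι _ _⟩)
          rw [← Category.id_comp (x ≫ t), ← Category.id_comp (y ≫ t), ← hk]
          simpa only [Category.assoc] using
            k ≫= equalizer.condition ((x ≫ t) ≫ prod.snd) ((y ≫ t) ≫ prod.snd)
      rw [ht, ← Category.assoc, ← Category.assoc, cancel_mono] at this
      rwa [cancel_mono] at this
    have hf : ∃ z : A ⟶ pullback t₁ t₂, z ≫ t = prod.lift l f := by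
      obtain ⟨k₁, e₁⟩ := (h₁ (prod.lift l f)).2 fun Z y a ha => by
        have e₁ := ha =≫ prod.fst
        have e₂ := ha =≫ prod.snd
        simp only [Category.assoc, prod.lift_fst, prod.lift_snd, prod.map_fst, prod.map_snd,
          Category.comp_id] at e₁ e₂
        rw [← Category.assoc, cancel_mono] at e₁
        exact ⟨y, prod.hom_ext (by rw [Category.assoc, prod.lift_fst, Category.comp_id, e₁])
          (by rw [Category.assoc, prod.lift_snd, e₂])⟩
      obtain ⟨k₂, e₂⟩ := (h₂ (prod.lift l f)).2 fun Z y a ha => by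
        have e₁ := ha =≫ prod.fst
        simp only [Category.assoc, prod.lift_fst, prod.map_fst] at e₁
        -- The condition from r is vacuous on the image of l: an element in both images lives over
        -- an absurd object.
        obtain ⟨O, hO, ⟨z⟩⟩ := hd y (a ≫ prod.fst) (by rw [← e₁, Category.assoc])
        exact ⟨a ≫ prod.fst, hO.hom_eq z _ _⟩
      exact ⟨pullback.lift k₁ k₂ (e₁.trans e₂.symm), by rw [pullback.lift_fst_assoc, e₁]⟩
    have hg : ∃ z : B ⟶ pullback t₁ t₂, z ≫ t = prod.lift r g := by
      obtain ⟨k₂, e₂⟩ := (h₂ (prod.lift r g)).2 fun Z y a ha => by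
        have e₁ := ha =≫ prod.fst
        have e₂ := ha =≫ prod.snd
        simp only [Category.assoc, prod.lift_fst, prod.lift_snd, prod.map_fst, prod.map_snd,
          Category.comp_id] at e₁ e₂
        rw [← Category.assoc, cancel_mono] at e₁
        exact ⟨y, prod.hom_ext (by rw [Category.assoc, prod.lift_fst, Category.comp_id, e₁])
          (by rw [Category.assoc, prod.lift_snd, e₂])⟩
      obtain ⟨k₁, e₁⟩ := (h₁ (prod.lift r g)).2 fun Z y a ha => by
        have e₁ := ha =≫ prod.fst
        simp only [Category.assoc, prod.lift_fst, prod.map_fst] at e₁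
        obtain ⟨O, hO, ⟨z⟩⟩ := hd (a ≫ prod.fst) y (by rw [← e₁, Category.assoc])
        exact ⟨a ≫ prod.fst, hO.hom_eq z _ _⟩
      exact ⟨pullback.lift k₁ k₂ (e₁.trans e₂.symm), by rw [pullback.lift_fst_assoc, e₁]⟩
    obtain ⟨zf, hzf⟩ := hf
    obtain ⟨zg, hzg⟩ := hg
    have ef : zf ≫ t ≫ prod.fst = l := by rw [reassoc_of% hzf, prod.lift_fst]
    have eg : zg ≫ t ≫ prod.fst = r := by rw [reassoc_of% hzg, prod.lift_fst]
    -- The graph is defined on the images of l and r, which cover S, hence on all of S.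
    obtain ⟨k, hk⟩ := h (𝟙 S) (t ≫ prod.fst)
      (fun Z' y a ha => ⟨a ≫ zf, by rw [Category.assoc, ef, ha, Category.comp_id]⟩)
      (fun Z' y a ha => ⟨a ≫ zg, by rw [Category.assoc, eg, ha, Category.comp_id]⟩)
    refine ⟨k ≫ t ≫ prod.snd, ?_, ?_⟩
    · have : l ≫ k = zf := by rw [← cancel_mono (t ≫ prod.fst), Category.assoc, hk, ef,
        Category.comp_id]
      rw [reassoc_of% this, reassoc_of% hzf, prod.lift_snd]
    · have : r ≫ k = zg := by rw [← cancel_mono (t ≫ prod.fst), Category.assoc, hk, eg,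
        Category.comp_id]
      rw [reassoc_of% this, reassoc_of% hzg, prod.lift_snd]
  choose desc hl hr using @H
  exact ⟨BinaryCofan.IsColimit.mk _ (fun f g => desc f g) (fun f g => hl f g) (fun f g => hr f g)
    (fun f g m e₁ e₂ => h.hom_ext (e₁.trans (hl f g).symm) (e₂.trans (hr f g).symm))⟩

end Initial

/-! ### The canonical morphism 1 + 1 → Ω -/

section TrueFalse

lemma exists_desc_of_isColimit {C : Type u} [Category.{v} C] {A B S Y : C} {l : A ⟶ S} {r : B ⟶ S}
    (hS : IsColimit (BinaryCofan.mk l r)) (f : A ⟶ Y) (g : B ⟶ Y) :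
    ∃ x : S ⟶ Y, l ≫ x = f ∧ r ≫ x = g :=
  ⟨_, (BinaryCofan.IsColimit.desc' hS f g).2⟩

lemma hom_ext_of_isColimit {C : Type u} [Category.{v} C] {A B S Y : C} {l : A ⟶ S} {r : B ⟶ S}
    (hS : IsColimit (BinaryCofan.mk l r)) {x y : S ⟶ Y} (hl : l ≫ x = l ≫ y)
    (hr : r ≫ x = r ≫ y) : x = y :=
  BinaryCofan.IsColimit.hom_ext hS hl hr

variable {C : Type u} [Category.{v} C] [IsElementaryTopos C]

/-- The union of true and false inside Ω is already the coproduct, because the two are disjoint. -/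
lemma exists_trueFalse (c : Subobject.Classifier C) {O : C} (hO : IsInitial O)
    {fls : c.Ω₀ ⟶ c.Ω} (hfls : IsPullback (hO.to c.Ω₀) (hO.to c.Ω₀) fls c.truth) :
    ∃ (S : C) (inl inr : c.Ω₀ ⟶ S) (b : S ⟶ c.Ω), Mono b ∧ inl ≫ b = c.truth ∧ inr ≫ b = fls ∧
      PairCover inl inr ∧ Nonempty (IsColimit (BinaryCofan.mk inl inr)) := by
  obtain ⟨S, b, inl, inr, hb, hl, hr, h⟩ := exists_pairCover_image c.truth fls
  have : Mono inl := c.isTerminalΩ₀.mono_from _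
  have : Mono inr := c.isTerminalΩ₀.mono_from _
  exact ⟨S, inl, inr, b, hb, hl, hr, h, isColimit_of_pairCover c inl inr
    (disjoint_of_isPullback c (isAbsurd_of_isInitial c hO) hfls hl hr) h⟩

variable (C) in
lemma exists_isTrueFalse : ∃ (S Ω : C) (b : S ⟶ Ω), IsTrueFalse b := by
  obtain ⟨c⟩ := exists_classifier C
  obtain ⟨O, h⟩ := exists_isAbsurd c
  obtain ⟨hO⟩ := h.isInitial
  have := mono_of_isInitial hO (hO.to c.Ω₀)
  have hfls : IsPullback (hO.to c.Ω₀) (hO.to c.Ω₀) (c.χ (hO.to c.Ω₀)) c.truth := by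
    have := c.isPullback (hO.to c.Ω₀)
    rwa [Subsingleton.elim (c.χ₀ O) (hO.to c.Ω₀)] at this
  obtain ⟨S, inl, inr, b, -, hl, hr, -, hS⟩ := exists_trueFalse c hO hfls
  exact ⟨S, c.Ω, b, .mk c hO _ hfls inl inr hS b hl hr⟩

/-- Any coproduct 1 + 1 is isomorphic, compatibly with b, to the union of true and false in Ω. -/
lemma mono_and_pairCover_of_isColimit (c : Subobject.Classifier C) {O : C} (hO : IsInitial O)
    {fls : c.Ω₀ ⟶ c.Ω} (hfls : IsPullback (hO.to c.Ω₀) (hO.to c.Ω₀) fls c.truth) {S : C}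
    {inl inr : c.Ω₀ ⟶ S} (hS : IsColimit (BinaryCofan.mk inl inr)) {b : S ⟶ c.Ω}
    (hl : inl ≫ b = c.truth) (hr : inr ≫ b = fls) : Mono b ∧ PairCover inl inr := by
  obtain ⟨S', inl', inr', b', hb', hl', hr', h, -⟩ := exists_trueFalse c hO hfls
  obtain ⟨x, hx₁, hx₂⟩ := exists_desc_of_isColimit hS inl' inr'
  obtain ⟨y, hy₁, hy₂⟩ : ∃ y : S' ⟶ S, inl' ≫ y = inl ∧ inr' ≫ y = inr := by
    have : Mono inl' := c.isTerminalΩ₀.mono_from _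
    have : Mono inr' := c.isTerminalΩ₀.mono_from _
    obtain ⟨hS'⟩ := isColimit_of_pairCover c inl' inr'
      (disjoint_of_isPullback c (isAbsurd_of_isInitial c hO) hfls hl' hr') h
    exact exists_desc_of_isColimit hS' inl inr
  have hxy : x ≫ y = 𝟙 S := hom_ext_of_isColimit hS
    (by simp [reassoc_of% hx₁, hy₁]) (by simp [reassoc_of% hx₂, hy₂])
  have hyx : y ≫ x = 𝟙 S' := h.hom_ext (by simp [reassoc_of% hy₁, hx₁])
    (by simp [reassoc_of% hy₂, hx₂])
  have e : x ≫ b' = b := hom_ext_of_isColimit hS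
    (by simp [reassoc_of% hx₁, hl, hl']) (by simp [reassoc_of% hx₂, hr, hr'])
  have : IsIso x := ⟨y, hxy, hyx⟩
  refine ⟨e ▸ mono_comp x b', fun Z E s e _ h₁ h₂ => h (s ≫ x) e (fun Z' z a ha => h₁ z a ?_)
    (fun Z' z a ha => h₂ z a ?_)⟩
  · rw [← cancel_mono x, Category.assoc, hx₁, ha, Category.assoc]
  · rw [← cancel_mono x, Category.assoc, hx₂, ha, Category.assoc]

lemma IsTrueFalse.mono {S Ω : C} {b : S ⟶ Ω} (h : IsTrueFalse b) : Mono b := by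
  obtain ⟨c, hO, fls, hfls, inl, inr, ⟨hS⟩, b, hl, hr⟩ := h
  exact (mono_and_pairCover_of_isColimit c hO hfls hS hl hr).1

/-- Preservation of coproducts is not given. But F preserves the classifier, the initial object and
covering pairs, and a disjoint covering pair of monos is a coproduct. -/
lemma IsTrueFalse.map {D : Type u'} [Category.{v'} D] [IsElementaryTopos D] {F : C ⥤ D}
    (hF : IsLogical F) {S Ω : C} {b : S ⟶ Ω} (h : IsTrueFalse b) : IsTrueFalse (F.map b) := by
  have := hF.preservesFiniteLimits
  obtain ⟨c, hO, fls, hfls, inl, inr, ⟨hS⟩, b, hl, hr⟩ := h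
  obtain ⟨hO'⟩ := isInitial_map hF hO
  have e : F.map (hO.to c.Ω₀) = hO'.to _ := hO'.hom_ext _ _
  have hfls' := hfls.map F
  rw [e] at hfls'
  have hl' := congrArg F.map hl
  have hr' := congrArg F.map hr
  rw [F.map_comp] at hl' hr'
  let c' := mapClassifier hF c
  have : Mono (F.map inl) := c'.isTerminalΩ₀.mono_from _
  have : Mono (F.map inr) := c'.isTerminalΩ₀.mono_from _
  exact .mk c' hO' (F.map fls) hfls' (F.map inl) (F.map inr)
    (isColimit_of_pairCover c' (F.map inl) (F.map inr)
      (disjoint_of_isPullback c' (isAbsurd_of_isInitial c' hO') hfls' hl' hr')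
      ((mono_and_pairCover_of_isColimit c hO hfls hS hl hr).2.map hF)) (F.map b) hl' hr'

/-- Truth values decided by one `[true, false]` are decided by any other. -/
lemma IsTrueFalse.exists_factorization {S Ω S' Ω' : C} {b : S ⟶ Ω} {b' : S' ⟶ Ω'}
    (h : IsTrueFalse b) (h' : IsTrueFalse b') :
    ∃ (s : Ω' ⟶ Ω) (g : S ⟶ S') (w : Ω ⟶ Ω'), s ≫ w = 𝟙 Ω' ∧ g ≫ b' = b ≫ w := by
  obtain ⟨c, hO, fls, hfls, inl, inr, ⟨hS⟩, b, hl, hr⟩ := h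
  obtain ⟨c', hO', fls', hfls', inl', inr', -, b', hl', hr'⟩ := h'
  obtain ⟨g, hg₁, hg₂⟩ := exists_desc_of_isColimit hS (c'.χ₀ c.Ω₀ ≫ inl') (c'.χ₀ c.Ω₀ ≫ inr')
  have := mono_of_isInitial hO (hO.to c.Ω₀)
  -- The comparison of the two classifiers: each Ω classifies the truth morphism of the other.
  refine ⟨c.χ c'.truth, g, c'.χ c.truth, ?_, hom_ext_of_isColimit hS ?_ ?_⟩
  · have e₁ := c'.uniq _ ((c.isPullback c'.truth).paste_vert (c'.isPullback c.truth))
    have e₂ : 𝟙 _ = c'.χ c'.truth := c'.uniq (χ₀' := 𝟙 _) _ (IsPullback.of_vert_isIso ⟨by simp⟩)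
    rw [e₁, e₂]
  · rw [reassoc_of% hg₁, reassoc_of% hl, hl', (c'.isPullback c.truth).w]
  · rw [reassoc_of% hg₂, reassoc_of% hr, hr', c'.uniq _ (hfls.paste_vert (c'.isPullback c.truth)),
      c'.uniq (hO.to c.Ω₀) (χ₀' := hO.to c'.Ω₀) (χ' := c'.χ₀ c.Ω₀ ≫ fls')]
    have : IsIso (c'.χ₀ c.Ω₀) := ⟨c.χ₀ _, Subsingleton.elim _ _, Subsingleton.elim _ _⟩
    have : IsIso (hO.to _) := ⟨hO'.to _, hO.hom_ext _ _, hO'.hom_ext _ _⟩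
    have sq := (IsPullback.of_horiz_isIso (snd := hO.to c.Ω₀) (f := hO'.to c'.Ω₀)
      ⟨hO.hom_ext (hO.to _ ≫ hO'.to c'.Ω₀) (hO.to c.Ω₀ ≫ c'.χ₀ c.Ω₀)⟩).paste_horiz hfls'.flip
    rw [hO.hom_ext (hO.to _ ≫ hO'.to c'.Ω₀) (hO.to c'.Ω₀)] at sq
    exact sq.flip

end TrueFalse

/-! ### Comparison with the right adjoint on subobjects -/

section Forall

variable {C : Type u} [Category.{v} C]

lemma le_mk_iff_liftsThru {A T : C} (R : Subobject A) (t : T ⟶ A) [Mono t] :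
    R ≤ Subobject.mk t ↔ LiftsThru t R.arrow :=
  ⟨fun h => ⟨_, Subobject.ofLEMk_comp h⟩, fun ⟨k, hk⟩ => Subobject.le_mk_of_comm k hk⟩

variable [IsElementaryTopos C]

lemma IsUForall.isForall {A A' S T : C} {g : A ⟶ A'} {s : S ⟶ A} {t : T ⟶ A'} [Mono s] [Mono t]
    (h : IsUForall g s t) : IsForall g (Subobject.mk s) (Subobject.mk t) := by
  intro R
  have sq := Subobject.isPullback g R
  rw [le_mk_iff_liftsThru, le_mk_iff_liftsThru, h]
  constructor
  · intro H
    exact H (Subobject.pullbackπ g R) _ sq.w.symm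
  · intro H Z' y a ha
    have := H.precomp (sq.lift y a ha.symm)
    rwa [sq.lift_snd] at this

/-- The value of a right adjoint is unique, so T is the subobject built from the power object, which
has the property at all stages. -/
lemma IsForall.isUForall {A A' S : C} {g : A ⟶ A'} {s : S ⟶ A} [Mono s] {T : Subobject A'}
    (h : IsForall g (Subobject.mk s) T) : IsUForall g s T.arrow := by
  obtain ⟨T', t, _, ht⟩ := exists_isUForall g s
  have h' := ht.isForall
  obtain rfl : T = Subobject.mk t :=
    le_antisymm ((h' _).2 ((h _).1 le_rfl)) ((h _).2 ((h' _).1 le_rfl))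
  exact ht.of_equiv ((le_mk_iff_liftsThru _ t).1 le_rfl)
    ⟨_, Subobject.underlyingIso_arrow t⟩

end Forall

/-! ### Morphisms that become epi over U -/

section OpenClass

variable {C : Type u} [Category.{v} C]

/-- The class of the morphisms which become epimorphisms over `U`. -/
def openClass (U : C) : MorphismProperty C := fun X Y f =>
  ∀ ⦃Z Q : C⦄ (_ : Z ⟶ U) (s : Z ⟶ Y) (h : Q ⟶ Z) (k : Q ⟶ X), IsPullback h k s f → Epi h

lemma openClass_of_exists {U X Y : C} {f : X ⟶ Y}
    (H : ∀ ⦃Z : C⦄ (_ : Z ⟶ U) (s : Z ⟶ Y), ∃ (Q : C) (h : Q ⟶ Z) (k : Q ⟶ X),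
      IsPullback h k s f ∧ Epi h) : openClass U f := by
  intro Z Q x s h k sq
  obtain ⟨Q', h', k', sq', _⟩ := H x s
  rw [← sq.isoIsPullback_hom_fst _ _ sq']
  exact epi_comp _ _

lemma openClass_of_liftsThru [HasPullbacks C] {U X Y : C} {f : X ⟶ Y}
    (H : ∀ ⦃Z : C⦄ (_ : Z ⟶ U) (s : Z ⟶ Y), LiftsThru f s) : openClass U f := by
  refine openClass_of_exists fun Z x s =>
    ⟨_, _, _, IsPullback.of_hasPullback s f, ?_⟩
  obtain ⟨k, hk⟩ := H x s
  have : IsSplitEpi (pullback.fst s f) :=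
    ⟨⟨⟨pullback.lift (𝟙 Z) k (by rw [hk, Category.id_comp]), pullback.lift_fst _ _ _⟩⟩⟩
  infer_instance

variable [IsElementaryTopos C]

/-- One universal stage suffices. It is stated for any V through which stages over U factor, so that
V may be the image of U × Y under a functor. -/
lemma openClass_of_isPullback {U V X Y Q : C} {f : X ⟶ Y} {π : V ⟶ Y}
    (hπ : ∀ ⦃Z : C⦄ (_ : Z ⟶ U) (s : Z ⟶ Y), LiftsThru π s) {h : Q ⟶ V} {k : Q ⟶ X}
    (sq : IsPullback h k π f) [Epi h] : openClass U f := by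
  refine openClass_of_exists fun Z x s => ?_
  obtain ⟨z, rfl⟩ := hπ x s
  exact ⟨_, _, _, (IsPullback.of_hasPullback z h).paste_vert sq, inferInstance⟩

/-- Pulled back along s, the mono f is also epi, hence invertible. -/
lemma openClass.liftsThru {U X Y : C} {f : X ⟶ Y} [Mono f] (hf : openClass U f) {Z : C}
    (x : Z ⟶ U) (s : Z ⟶ Y) : LiftsThru f s := by
  have := hf x s _ _ (IsPullback.of_hasPullback s f)
  have := isIso_of_mono_of_epi' (pullback.fst s f)
  exact ⟨inv (pullback.fst s f) ≫ pullback.snd s f, by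
    rw [Category.assoc, ← pullback.condition, IsIso.inv_hom_id_assoc]⟩

/-- Most axioms restate the stability of epis under pullback and composition. For ∀: at stages over
U the subobjects m and B coincide, so the two universal quantifications have the same elements
there. -/
instance (U : C) : IsLogicalClass (openClass U) where
  id_mem X := openClass_of_liftsThru fun Z _ s => ⟨s, Category.comp_id s⟩
  comp_mem f g hf hg := openClass_of_exists fun Z x s => by
    have sq := IsPullback.of_hasPullback s g
    have sq' := IsPullback.of_hasPullback (pullback.snd s g) f
    have := hg x s _ _ sq
    have := hf (pullback.fst s g ≫ x) _ _ _ sq'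
    exact ⟨_, _, _, (sq'.flip.paste_vert sq.flip).flip, epi_comp _ _⟩
  of_isPullback sq hg := fun Z Q x s h k sq' => hg x _ _ _ (sq'.flip.paste_horiz sq |>.flip)
  epi_mem X Y f _ := fun Z Q x s h k sq => epi_of_isPullback sq.flip
  mono_part_mem X I Y e m _ _ H := fun Z Q x s h k sq => by
    have sq' := IsPullback.of_hasPullback k e
    have := H x s _ _ (sq'.flip.paste_vert sq.flip).flip
    exact epi_of_epi (pullback.fst k e) h
  forall_mem M B A A' m f g _ _ hm S T hS hT h := openClass_of_liftsThru fun Z x s => by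
    obtain ⟨k, hk⟩ := (hS.isUForall (s ≫ T.arrow)).2 fun Z' y a ha => by
      obtain ⟨b, rfl⟩ := (hT.isUForall (s ≫ T.arrow)).1 (liftsThru_comp _ _) y a ha
      obtain ⟨b', rfl⟩ := hm.liftsThru (y ≫ x) b
      exact ⟨b', (Category.assoc _ _ _).symm⟩
    exact ⟨k, by rw [← cancel_mono T.arrow, Category.assoc, Subobject.ofLE_arrow, hk]⟩

end OpenClass

/-! ### The truth value of excluded middle and the class B(T) -/

section Locus

variable {C : Type u} [Category.{v} C]

/-- `U` is the truth value of `∀ p, p ∨ ¬ p`: every truth value at a stage over `U`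
lifts through `b`. -/
structure IsBoolLocus {S Ω : C} (b : S ⟶ Ω) (U : C) : Prop where
  hom_eq : ∀ ⦃Z : C⦄ (x y : Z ⟶ U), x = y
  nonempty_iff : ∀ ⦃Z : C⦄, Nonempty (Z ⟶ U) ↔ ∀ ⦃Z' : C⦄ (_ : Z' ⟶ Z) (p : Z' ⟶ Ω), LiftsThru b p

lemma IsBoolLocus.liftsThru {S Ω : C} {b : S ⟶ Ω} {U : C} (h : IsBoolLocus b U) {Z : C} (x : Z ⟶ U)
    (p : Z ⟶ Ω) : LiftsThru b p :=
  h.nonempty_iff.1 ⟨x⟩ (𝟙 Z) p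

lemma IsBoolLocus.isUForall {S Ω : C} {b : S ⟶ Ω} {U T : C} (h : IsBoolLocus b U)
    (hT : IsTerminal T) (g : Ω ⟶ T) (t : U ⟶ T) : IsUForall g b t := by
  intro Z x
  constructor
  · rintro ⟨k, -⟩ Z' y a -
    exact h.liftsThru (y ≫ k) a
  · intro H
    obtain ⟨k⟩ := h.nonempty_iff.2 fun Z' y p => H y p (hT.hom_ext _ _)
    exact ⟨k, hT.hom_ext _ _⟩

lemma IsBoolLocus.of_isUForall {S Ω : C} {b : S ⟶ Ω} {U T : C} (hT : IsTerminal T) {g : Ω ⟶ T}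
    {t : U ⟶ T} [Mono t] (h : IsUForall g b t) : IsBoolLocus b U where
  hom_eq Z x y := by rw [← cancel_mono t]; exact hT.hom_ext _ _
  nonempty_iff Z := by
    refine ⟨fun ⟨k⟩ Z' y p => (h (k ≫ t)).1 (liftsThru_comp _ _) y p (hT.hom_ext _ _), fun H => ?_⟩
    obtain ⟨k, -⟩ := (h (hT.from Z)).2 fun Z' y a _ => H y a
    exact ⟨k⟩

variable [IsElementaryTopos C]

lemma exists_isBoolLocus {S Ω : C} (b : S ⟶ Ω) [Mono b] : ∃ U : C, IsBoolLocus b U := by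
  obtain ⟨U, t, _, h⟩ := exists_isUForall (terminal.from Ω) b
  exact ⟨U, .of_isUForall terminalIsTerminal h⟩

lemma IsBoolLocus.map {D : Type u'} [Category.{v'} D] [IsElementaryTopos D] {F : C ⥤ D}
    (hF : IsLogical F) {S Ω : C} {b : S ⟶ Ω} [Mono b] {U : C} (h : IsBoolLocus b U) :
    IsBoolLocus (F.map b) (F.obj U) := by
  have := hF.preservesFiniteLimits
  have : Mono (terminal.from U) := ⟨fun x y _ => h.hom_eq x y⟩
  exact .of_isUForall (terminalIsTerminal.isTerminalObj F _)
    ((h.isUForall terminalIsTerminal (terminal.from _) (terminal.from _)).map hF)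

lemma IsBoolLocus.openClass_of_isTrueFalse {S Ω S' Ω' : C} {b : S ⟶ Ω} {b' : S' ⟶ Ω'} {U : C}
    (h : IsBoolLocus b U) (hb : IsTrueFalse b) (hb' : IsTrueFalse b') : openClass U b' := by
  obtain ⟨s, g, w, hs, hg⟩ := hb.exists_factorization hb'
  refine openClass_of_liftsThru fun Z x p => ?_
  obtain ⟨k, hk⟩ := h.liftsThru x (p ≫ s)
  exact ⟨k ≫ g, by rw [Category.assoc, hg, reassoc_of% hk, hs, Category.comp_id]⟩

/-- The ∀ axiom with f the identity: quantifying the whole of B gives the whole of X. -/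
lemma forall_mem_of_isUForall (W : MorphismProperty C) [IsLogicalClass W] {M B X T : C}
    {m : M ⟶ B} [Mono m] (hm : W m) {g : B ⟶ X} {t : T ⟶ X} [Mono t] (h : IsUForall g m t) :
    W t := by
  have h₁ := h.isForall
  have h₂ : IsForall g (Subobject.mk (𝟙 B)) ⊤ := fun R => by
    rw [← Subobject.top_eq_id]
    exact iff_of_true le_top le_top
  have h₃ := IsLogicalClass.forall_mem (W := W) m (𝟙 B) g hm (Subobject.mk t) ⊤
    (by simpa only [Category.comp_id] using h₁) h₂ le_top
  have e : t = (Subobject.underlyingIso t).inv ≫ Subobject.ofLE _ _ le_top ≫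
      (⊤ : Subobject X).arrow := by simp
  rw [e]
  exact W.comp_mem _ _ (iso_mem W _) (W.comp_mem _ _ h₃ (iso_mem W _))

/-- The subobjects in a logical class are closed upwards. -/
lemma mem_of_liftsThru (W : MorphismProperty C) [IsLogicalClass W] {M N B : C} {m : M ⟶ B}
    {n : N ⟶ B} [Mono m] [Mono n] (hm : W m) (h : LiftsThru n m) : W n := by
  obtain ⟨c⟩ := exists_classifier C
  -- In the internal language g₀ x = (x, true), H = {(x, p) | p → x ∈ n} and X = {(x, p) | (p → x ∈
  -- n) → x ∈ n}. The image of g₀ lies in X.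
  let g₀ : B ⟶ B ⨯ c.Ω := prod.lift (𝟙 B) (c.χ₀ B ≫ c.truth)
  have : Mono g₀ := mono_of_mono_fac (prod.lift_fst (𝟙 B) (c.χ₀ B ≫ c.truth))
  obtain ⟨H, ι, _, hH⟩ := exists_isUForall g₀ n
  obtain ⟨X, j, _, hX⟩ := exists_isUForall ι (pullback.fst (ι ≫ prod.fst) n)
  replace hX {Z : C} (x : Z ⟶ B ⨯ c.Ω) : LiftsThru j x ↔ ∀ ⦃Z' : C⦄ (y : Z' ⟶ Z) (a : Z' ⟶ H),
      a ≫ ι = y ≫ x → LiftsThru n (y ≫ x ≫ prod.fst) := by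
    refine (hX x).trans (forall_congr' fun Z' => forall_congr' fun y => forall_congr' fun a =>
      imp_congr_right fun ha => ?_)
    rw [liftsThru_of_isPullback (IsPullback.of_hasPullback _ _), reassoc_of% ha]
  have hg₀ {Z Z' : C} (x : Z ⟶ B) (a : Z' ⟶ B) (y : Z' ⟶ Z) (p : Z ⟶ c.Ω)
      (e : a ≫ g₀ = y ≫ prod.lift x p) : a = y ≫ x ∧ LiftsThru c.truth (y ≫ p) := by
    have e₁ := e =≫ prod.fst
    have e₂ := e =≫ prod.snd
    simp only [g₀, Category.assoc, prod.lift_fst, prod.lift_snd, Category.comp_id] at e₁ e₂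
    exact ⟨e₁, e₂ ▸ ⟨a ≫ c.χ₀ B, Category.assoc _ _ _⟩⟩
  obtain ⟨g, hg⟩ := (hX g₀).2 fun Z y a ha => by
    have := (hH (y ≫ g₀)).1 ⟨a, ha⟩ (𝟙 Z) y (Category.id_comp _).symm
    rwa [prod.lift_fst, Category.comp_id]
  have hπ : g ≫ j ≫ prod.fst = 𝟙 B := by rw [reassoc_of% hg, prod.lift_fst]
  have : IsSplitEpi (j ≫ prod.fst) := ⟨⟨⟨g, hπ⟩⟩⟩
  have : Mono g := mono_of_mono_fac hπ
  -- M' = {(x, p) ∈ X | p → x ∈ m}. Its inclusion in X lies in W by the ∀ axiom, and X → B does too,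
  -- being split by g.
  obtain ⟨M', μ, _, hM'⟩ := exists_isUForall g m
  have hμ : W (μ ≫ j ≫ prod.fst) := W.comp_mem _ _ (forall_mem_of_isUForall W hm hM')
    (IsLogicalClass.epi_mem _ inferInstance)
  -- On M', p implies x ∈ m and so x ∈ n; thus (x, p) ∈ H, and membership in X gives x ∈ n.
  obtain ⟨f, hf⟩ : LiftsThru n (μ ≫ j ≫ prod.fst) := by
    obtain ⟨k, hk⟩ := (hH (μ ≫ j)).2 fun Z y a ha => by
      rw [← hg, ← Category.assoc, ← Category.assoc, cancel_mono] at ha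
      exact ((hM' μ).1 (liftsThru_self μ) y a ha).trans h
    have := (hX (μ ≫ j)).1 (liftsThru_comp _ _) (𝟙 _) k (by rw [hk, Category.id_comp])
    rwa [Category.id_comp, Category.assoc] at this
  -- A section of f: x ∈ n goes to (x, [x ∈ m]), which lies in X because x ∈ n, and in M' trivially.
  -- So f is epi and n is the mono part of a member of W.
  obtain ⟨s, hs⟩ := (hX (prod.lift n (n ≫ c.χ m))).2 fun Z y a ha => by
    rw [prod.lift_fst]
    exact liftsThru_comp _ _
  obtain ⟨r, hr⟩ := (hM' s).2 fun Z y a ha => by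
    obtain ⟨rfl, h'⟩ := hg₀ n a y (n ≫ c.χ m) (by rw [← hs, ← hg, reassoc_of% ha])
    rwa [← liftsThru_truth_χ c, Category.assoc]
  have hrf : r ≫ f = 𝟙 N := by
    rw [← cancel_mono n, Category.assoc, hf, reassoc_of% hr, reassoc_of% hs, prod.lift_fst,
      Category.id_comp]
  have : IsSplitEpi f := ⟨⟨⟨r, hrf⟩⟩⟩
  exact IsLogicalClass.mono_part_mem f n inferInstance inferInstance (hf ▸ hμ)

lemma IsBoolLocus.openClass_eq_boolClass {S Ω : C} {b : S ⟶ Ω} {U : C} (h : IsBoolLocus b U)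
    (hb : IsTrueFalse b) : openClass U = boolClass C := by
  have := hb.mono
  refine le_antisymm ?_ fun X Y f hf =>
    hf (openClass U) inferInstance fun _ _ _ hb' => h.openClass_of_isTrueFalse hb hb'
  intro X Y f hf W hL hW
  have : Mono (terminal.from U) := ⟨fun x y _ => h.hom_eq x y⟩
  have hU : W (terminal.from U) := forall_mem_of_isUForall W (hW b hb)
    (h.isUForall terminalIsTerminal (terminal.from _) (terminal.from _))
  have hY : W (prod.snd : U ⨯ Y ⟶ Y) :=
    W.of_isPullback (IsPullback.of_isLimit_binaryFan_of_isTerminal (prodIsProd U Y)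
      terminalIsTerminal) hU
  have : Mono (prod.snd : U ⨯ Y ⟶ Y) := ⟨fun x y e => prod.hom_ext (h.hom_eq _ _) e⟩
  obtain ⟨I, e, m, he, hm, rfl⟩ := exists_epi_mono f
  -- Hence m contains every element at a stage over U, in particular the subobject U × Y of Y.
  have hm' : openClass U m := IsLogicalClass.mono_part_mem e m he hm hf
  exact W.comp_mem _ _ (IsLogicalClass.epi_mem e he)
    (mem_of_liftsThru W hY (hm'.liftsThru prod.fst prod.snd))

variable (C) in
lemma exists_openClass_eq_boolClass : ∃ (S Ω : C) (b : S ⟶ Ω) (U : C), IsTrueFalse b ∧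
    IsBoolLocus b U ∧ openClass U = boolClass C := by
  obtain ⟨S, Ω, b, hb⟩ := exists_isTrueFalse C
  have := hb.mono
  obtain ⟨U, hU⟩ := exists_isBoolLocus b
  exact ⟨S, Ω, b, U, hb, hU, hU.openClass_eq_boolClass hb⟩

lemma openClass_map {D : Type u'} [Category.{v'} D] [IsElementaryTopos D] {F : C ⥤ D}
    (hF : IsLogical F) {U X Y : C} {f : X ⟶ Y} (h : openClass U f) :
    openClass (F.obj U) (F.map f) := by
  have := hF.preservesFiniteLimits
  have sq := IsPullback.of_hasPullback (prod.snd : U ⨯ Y ⟶ Y) f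
  have := h prod.fst _ _ _ sq
  have := epi_map_of_isLogical hF (pullback.fst (prod.snd : U ⨯ Y ⟶ Y) f)
  refine openClass_of_isPullback (fun Z x s => ?_) (sq.map F)
  obtain ⟨z, -, hz⟩ := exists_lift_map_prod F x s
  exact ⟨z, hz⟩

/-- F(U) plays the role of U in the target, and being epi over U is a condition on one pullback
square, which F preserves along with epis. -/
lemma boolClass_le_inverseImage {D : Type u'} [Category.{v'} D] [IsElementaryTopos D] {F : C ⥤ D}
    (hF : IsLogical F) : boolClass C ≤ (boolClass D).inverseImage F := by
  obtain ⟨S, Ω, b, U, hb, hU, e⟩ := exists_openClass_eq_boolClass C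
  have := hb.mono
  rw [← e, ← (hU.map hF).openClass_eq_boolClass (hb.map hF)]
  exact fun X Y f hf => openClass_map hF hf

end Locus

/-! ### Classes of spans as relations between elements over U -/

section SpanRelation

variable {C : Type u} [Category.{v} C] [IsElementaryTopos C] {W : MorphismProperty C} {U : C}

/-- The elements `a` and `b`, at a stage over `U`, are related by `φ`. -/
def SpanHom.Holds (hW : W ≤ openClass U) {A B Z : C} (x : Z ⟶ U) (a : Z ⟶ A) (b : Z ⟶ B)
    (φ : SpanHom W A B) : Prop :=
  Quot.lift (fun S : Sp A B => ∃ (Z' : C) (e : Z' ⟶ Z) (d : Z' ⟶ S.apex), Epi e ∧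
    d ≫ S.l = e ≫ a ∧ d ≫ S.r = e ≫ b) (by
      rintro S T ⟨y, hy⟩
      refine propext ⟨fun ⟨Z', e, d, he, h₁, h₂⟩ => ⟨Z', e, d ≫ y.hom, he, ?_, ?_⟩,
        fun ⟨Z', e, d, he, h₁, h₂⟩ => ?_⟩
      · rw [Category.assoc, y.hom_l, h₁]
      · rw [Category.assoc, y.hom_r, h₂]
      -- At a stage over U the pullback of y is epi, so a witness for T lifts to one for S on a
      -- finer cover. This is where W ≤ openClass U is needed.
      · have := hW _ hy (e ≫ x) d _ _ (IsPullback.of_hasPullback d y.hom)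
        have w : pullback.fst d y.hom ≫ d = pullback.snd d y.hom ≫ y.hom := pullback.condition
        refine ⟨_, pullback.fst d y.hom ≫ e, pullback.snd d y.hom, epi_comp _ _, ?_, ?_⟩
        · rw [← y.hom_l, ← reassoc_of% w, h₁, Category.assoc]
        · rw [← y.hom_r, ← reassoc_of% w, h₂, Category.assoc]) φ

lemma SpanHom.holds_id (hW : W ≤ openClass U) {A Z : C} (x : Z ⟶ U) (a : Z ⟶ A) :
    SpanHom.Holds hW x a a (SpanHom.id W A) :=
  ⟨Z, 𝟙 Z, a, inferInstance, by simp, by simp⟩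

lemma SpanHom.eq_of_holds_graph (hW : W ≤ openClass U) {A B Z : C} {x : Z ⟶ U} {a : Z ⟶ A}
    {b : Z ⟶ B} {f : A ⟶ B} (h : SpanHom.Holds hW x a b (graph W f)) : b = a ≫ f := by
  obtain ⟨Z', e, d, he, h₁, h₂⟩ := h
  replace h₁ : d ≫ 𝟙 A = e ≫ a := h₁
  replace h₂ : d ≫ f = e ≫ b := h₂
  rw [← cancel_epi e, ← h₂, ← reassoc_of% h₁]

lemma SpanHom.holds_graph (hW : W ≤ openClass U) {A B Z : C} (x : Z ⟶ U) (a : Z ⟶ A)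
    (f : A ⟶ B) : SpanHom.Holds hW x a (a ≫ f) (graph W f) :=
  ⟨Z, 𝟙 Z, a, inferInstance, by simp, by simp⟩

lemma graph_injective (hW : W ≤ openClass U) {A B : C} (x : A ⟶ U) {f g : A ⟶ B}
    (h : graph W f = graph W g) : f = g := by
  have H := SpanHom.holds_graph hW x (𝟙 A) f
  rw [h] at H
  simpa only [Category.id_comp] using SpanHom.eq_of_holds_graph hW H

variable [IsLogicalClass W]

lemma SpanHom.Holds.of_le {hW : W ≤ openClass U} {A B Z : C} {x : Z ⟶ U} {a : Z ⟶ A} {b : Z ⟶ B}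
    {φ ψ : SpanHom W A B} (h : SpanHom.Holds hW x a b φ) (hle : SpanHom.Le W φ ψ) :
    SpanHom.Holds hW x a b ψ := by
  obtain ⟨S, T, rfl, rfl, ⟨y⟩⟩ := SpanHom.exists_of_le W hle
  obtain ⟨Z', e, d, he, h₁, h₂⟩ := h
  exact ⟨Z', e, d ≫ y.hom, he, by rw [Category.assoc, y.hom_l, h₁],
    by rw [Category.assoc, y.hom_r, h₂]⟩

/-- As A lies over U, its generic element may be tested. Totality makes the left leg epi;
single-valuedness makes the right leg constant on the fibres of the left one, so it descends. -/
lemma SpanHom.IsMap.exists_graph (hW : W ≤ openClass U) {A B : C} (x : A ⟶ U)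
    {φ : SpanHom W A B} (hφ : SpanHom.IsMap W φ) : ∃ f : A ⟶ B, graph W f = φ := by
  induction φ using Quot.ind with | _ S
  have : Epi S.l := by
    obtain ⟨Z', e, d, he, h₁, -⟩ := (SpanHom.holds_id hW x (𝟙 A)).of_le hφ.1
    rw [Category.comp_id] at h₁
    have e₁ : (d ≫ pullback.fst S.r S.r) ≫ S.l = e := (Category.assoc _ _ _).trans h₁
    exact epi_of_epi_fac e₁
  obtain ⟨f, hf⟩ := exists_desc_of_epi S.l S.r fun Z d d' h => by
    have H : SpanHom.Holds hW (d ≫ S.l ≫ x) (d ≫ S.r) (d' ≫ S.r) (SpanHom.mk W (S.conv.comp S)) :=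
      ⟨Z, 𝟙 Z, pullback.lift d d' h, inferInstance,
        (pullback.lift_fst_assoc d d' h S.r).trans (Category.id_comp _).symm,
        (pullback.lift_snd_assoc d d' h S.r).trans (Category.id_comp _).symm⟩
    have := SpanHom.eq_of_holds_graph (f := 𝟙 B) hW (H.of_le hφ.2)
    rw [this, Category.comp_id]
  exact ⟨f, (SpanHom.sound (S := S) (T := Sp.mk (𝟙 A) f) S.l (IsLogicalClass.epi_mem _ this)
    (Category.comp_id _) hf).symm⟩

lemma quotientFunctor_map_bijective (hW : W ≤ openClass U) {A : C}
    (x : A ⟶ U) (B : C) : Function.Bijective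
      (fun f : A ⟶ B => (quotientFunctor W).map f) := by
  constructor
  · intro f g h
    exact graph_injective hW x (congrArg InducedWideCategory.Hom.hom h)
  · intro φ
    obtain ⟨f, hf⟩ := SpanHom.IsMap.exists_graph hW x φ.property
    exact ⟨f, WideSubcategory.hom_ext _ hf⟩

variable (W)

/-- The inverse is [m, 1]. One composite is the identity because m is mono, the other is [m, m] =
[1, 1] because m ∈ W. -/
lemma isIso_quotientFunctor_map {M A : C} (m : M ⟶ A) [Mono m] (hm : W m) :
    IsIso ((quotientFunctor W).map m) := by
  let φ : SpanHom W A M := SpanHom.mk W (Sp.mk m (𝟙 M))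
  have h₁ : SpanHom.comp W (graph W m) φ = SpanHom.id W M :=
    SpanHom.sound (S := (Sp.mk (𝟙 M) m).comp (Sp.mk m (𝟙 M))) (T := Sp.mk (𝟙 M) (𝟙 M))
      (pullback.fst m m) (iso_mem W (pullback.fst m m)) rfl
      (congrArg (· ≫ 𝟙 M) ((cancel_mono m).1 (pullback.condition (f := m) (g := m))))
  have h₂ : SpanHom.comp W φ (graph W m) = SpanHom.id W A :=
    SpanHom.sound (S := (Sp.mk m (𝟙 M)).comp (Sp.mk (𝟙 M) m)) (T := Sp.mk (𝟙 A) (𝟙 A))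
      (pullback.fst (𝟙 M) (𝟙 M) ≫ m) (W.comp_mem _ _ (iso_mem W (pullback.fst (𝟙 M) (𝟙 M))) hm)
      (Category.comp_id _) ((Category.comp_id _).trans (congrArg (· ≫ m)
        ((cancel_mono (𝟙 M)).1 (pullback.condition (f := 𝟙 M) (g := 𝟙 M)))))
  have hφ : SpanHom.IsMap W φ := by
    have e : SpanHom.conv W φ = graph W m := rfl
    refine ⟨?_, ?_⟩
    · rw [e, h₂]
      exact SpanHom.le_refl W _
    · rw [e, h₁]
      exact SpanHom.le_refl W _
  exact ⟨⟨φ, hφ⟩, WideSubcategory.hom_ext _ h₁, WideSubcategory.hom_ext _ h₂⟩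

end SpanRelation

/-! ### Criteria for pullbacks and preservation of finite limits -/

section Pullbacks

variable {C : Type u} [Category.{v} C] {D : Type u'} [Category.{v'} D]

lemma isPullback_of_existsUnique {P X Y Z : C} {fst : P ⟶ X} {snd : P ⟶ Y} {f : X ⟶ Z} {g : Y ⟶ Z}
    (w : fst ≫ f = snd ≫ g)
    (h : ∀ ⦃T : C⦄ (a : T ⟶ X) (b : T ⟶ Y), a ≫ f = b ≫ g →
      ∃! z : T ⟶ P, z ≫ fst = a ∧ z ≫ snd = b) : IsPullback fst snd f g := by
  choose l hl hu using h
  exact ⟨⟨w⟩, ⟨PullbackCone.IsLimit.mk w (fun s => l s.fst s.snd s.condition)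
    (fun s => (hl _ _ s.condition).1) (fun s => (hl _ _ s.condition).2)
    (fun s m h₁ h₂ => hu _ _ s.condition m ⟨h₁, h₂⟩)⟩⟩

lemma preservesFiniteLimits_of_isPullback [HasFiniteLimits C] (F : C ⥤ D) {T : C}
    (hT : IsTerminal T) (hFT : IsTerminal (F.obj T))
    (h : ∀ ⦃P X Y Z : C⦄ ⦃fst : P ⟶ X⦄ ⦃snd : P ⟶ Y⦄ ⦃f : X ⟶ Z⦄ ⦃g : Y ⟶ Z⦄,
      IsPullback fst snd f g → IsPullback (F.map fst) (F.map snd) (F.map f) (F.map g)) :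
    PreservesFiniteLimits F := by
  have : PreservesLimit (Functor.empty.{0} C) F :=
    preservesLimit_of_preserves_limit_cone hT
      ((isLimitMapConeEmptyConeEquiv F T).symm hFT)
  have : PreservesLimitsOfShape (Discrete.{0} PEmpty) F :=
    preservesLimitsOfShape_pempty_of_preservesTerminal F
  have : PreservesLimitsOfShape WalkingCospan F := ⟨fun {K} => by
    have H : PreservesLimit (cospan (K.map WalkingCospan.Hom.inl) (K.map WalkingCospan.Hom.inr)) F :=
      have sq := IsPullback.of_hasPullback (K.map WalkingCospan.Hom.inl)
        (K.map WalkingCospan.Hom.inr)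
      preservesLimit_of_preserves_limit_cone sq.isLimit
        ((isLimitMapConePullbackConeEquiv F sq.w).symm (h sq).isLimit)
    exact preservesLimit_of_iso_diagram F (diagramIsoCospan K).symm⟩
  exact preservesFiniteLimits_of_preservesTerminal_and_pullbacks F

end Pullbacks

/-! ### Invariance and uniqueness of power objects -/

section PowerObject

variable {D : Type u'} [Category.{v'} D]

lemma IsPowerObject.of_iso {P E A P' E' A' : D} {p : E ⟶ P} {a : E ⟶ A} (h : IsPowerObject p a)
    (eP : P ≅ P') (eE : E ≅ E') (eA : A ≅ A') {p' : E' ⟶ P'} {a' : E' ⟶ A'}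
    (hp : p ≫ eP.hom = eE.hom ≫ p') (ha : a ≫ eA.hom = eE.hom ≫ a') : IsPowerObject p' a' where
  jointlyMono Z x y e₁ e₂ := by
    rw [← cancel_mono eE.inv]
    refine h.jointlyMono _ _ ?_ ?_
    · rw [← cancel_mono eP.hom, Category.assoc, Category.assoc, Category.assoc, Category.assoc, hp]
      simpa using e₁
    · rw [← cancel_mono eA.hom, Category.assoc, Category.assoc, Category.assoc, Category.assoc, ha]
      simpa using e₂
  existsUnique B R r s hrs := by
    obtain ⟨k, ⟨q, hq, sq⟩, hu⟩ := h.existsUnique r (s ≫ eA.inv) fun Z x y e₁ e₂ =>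
      hrs x y e₁ (by simpa [← Category.assoc] using e₂)
    refine ⟨k ≫ eP.hom, ⟨q ≫ eE.hom, ?_, ?_⟩, ?_⟩
    · rw [Category.assoc, ← ha, reassoc_of% hq, eA.inv_hom_id, Category.comp_id]
    · exact sq.of_iso (Iso.refl _) eE (Iso.refl _) eP (by simp) (by simp) hp (by simp)
    · rintro k' ⟨q', hq', sq'⟩
      rw [← hu (k' ≫ eP.inv) ⟨q' ≫ eE.inv, ?_, ?_⟩, Category.assoc, eP.inv_hom_id,
        Category.comp_id]
      · rw [← cancel_mono eA.hom, Category.assoc, Category.assoc, ha]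
        simp [hq']
      · refine sq'.of_iso (Iso.refl _) eE.symm (Iso.refl _) eP.symm (by simp) (by simp) ?_ (by simp)
        rw [Iso.symm_hom, Iso.symm_hom, Iso.comp_inv_eq, Category.assoc, hp, eE.inv_hom_id_assoc]

lemma IsPowerObject.exists_iso {P E A P' E' : D} {p : E ⟶ P} {a : E ⟶ A} {p' : E' ⟶ P'}
    {a' : E' ⟶ A} (h : IsPowerObject p a) (h' : IsPowerObject p' a') :
    ∃ (eP : P ≅ P') (eE : E ≅ E'), p ≫ eP.hom = eE.hom ≫ p' ∧ a = eE.hom ≫ a' := by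
  obtain ⟨k, ⟨q, hq, sq⟩, -⟩ := h'.existsUnique p a h.jointlyMono
  obtain ⟨k', ⟨q', hq', sq'⟩, -⟩ := h.existsUnique p' a' h'.jointlyMono
  have e₁ : k ≫ k' = 𝟙 P := (h.existsUnique p a h.jointlyMono).unique
    ⟨q ≫ q', by rw [Category.assoc, hq', hq], sq.paste_horiz sq'⟩
    ⟨𝟙 E, Category.id_comp a, IsPullback.of_horiz_isIso ⟨by simp⟩⟩
  have e₂ : k' ≫ k = 𝟙 P' := (h'.existsUnique p' a' h'.jointlyMono).unique
    ⟨q' ≫ q, by rw [Category.assoc, hq, hq'], sq'.paste_horiz sq⟩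
    ⟨𝟙 E', Category.id_comp a', IsPullback.of_horiz_isIso ⟨by simp⟩⟩
  refine ⟨⟨k, k', e₁, e₂⟩, ⟨q, q', ?_, ?_⟩, sq.w.symm, hq.symm⟩
  · refine h.jointlyMono _ _ ?_ ?_
    · rw [Category.assoc, sq'.w, reassoc_of% sq.w, e₁, Category.comp_id, Category.id_comp]
    · rw [Category.assoc, hq', hq, Category.id_comp]
  · refine h'.jointlyMono _ _ ?_ ?_
    · rw [Category.assoc, sq.w, reassoc_of% sq'.w, e₂, Category.comp_id, Category.id_comp]
    · rw [Category.assoc, hq, hq', Category.id_comp]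

end PowerObject

/-! ### Transport of topos structure along a local quotient -/

section LocalQuotient

variable {C : Type u} [Category.{v} C] {D : Type u'} [Category.{v'} D]

/-- The functor `H` exhibits `D` as the part of `C` seen from the objects in the sieve `V`. -/
structure IsLocalQuotient (H : C ⥤ D) (V : C → Prop) : Prop where
  sieve : ∀ ⦃Z X : C⦄, (Z ⟶ X) → V X → V Z
  bijective : ∀ ⦃X : C⦄, V X → ∀ Y : C, Function.Bijective (fun f : X ⟶ Y => H.map f)
  exists_iso : ∀ Y : D, ∃ X : C, V X ∧ Nonempty (H.obj X ≅ Y)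

namespace IsLocalQuotient

variable {H : C ⥤ D} {V : C → Prop} (hH : IsLocalQuotient H V)
include hH

/-- Only the test object needs to be in V: up to isomorphism it always is, and then cones and
fillers come uniquely from C. -/
lemma isPullback_map {P X Y Z : C} {fst : P ⟶ X} {snd : P ⟶ Y} {f : X ⟶ Z} {g : Y ⟶ Z}
    (sq : IsPullback fst snd f g) : IsPullback (H.map fst) (H.map snd) (H.map f) (H.map g) := by
  refine isPullback_of_existsUnique (by rw [← H.map_comp, sq.w, H.map_comp]) fun T a b hab => ?_
  obtain ⟨T₀, hT₀, ⟨i⟩⟩ := hH.exists_iso T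
  obtain ⟨a₀, ha₀⟩ := (hH.bijective hT₀ X).2 (i.hom ≫ a)
  obtain ⟨b₀, hb₀⟩ := (hH.bijective hT₀ Y).2 (i.hom ≫ b)
  dsimp only at ha₀ hb₀
  have e : a₀ ≫ f = b₀ ≫ g := (hH.bijective hT₀ Z).1 (by
    dsimp only
    rw [H.map_comp, H.map_comp, ha₀, hb₀, Category.assoc, Category.assoc, hab])
  refine ⟨i.inv ≫ H.map (sq.lift a₀ b₀ e), ⟨?_, ?_⟩, fun z hz => ?_⟩
  · rw [Category.assoc, ← H.map_comp, sq.lift_fst, ha₀, i.inv_hom_id_assoc]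
  · rw [Category.assoc, ← H.map_comp, sq.lift_snd, hb₀, i.inv_hom_id_assoc]
  · obtain ⟨z₀, hz₀⟩ := (hH.bijective hT₀ P).2 (i.hom ≫ z)
    dsimp only at hz₀
    rw [Iso.eq_inv_comp, ← hz₀]
    refine congrArg _ (sq.hom_ext ((hH.bijective hT₀ X).1 ?_) ((hH.bijective hT₀ Y).1 ?_))
    · dsimp only
      rw [sq.lift_fst, H.map_comp, hz₀, ha₀, Category.assoc, hz.1]
    · dsimp only
      rw [sq.lift_snd, H.map_comp, hz₀, hb₀, Category.assoc, hz.2]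

lemma isTerminal_obj {T : C} (hT : IsTerminal T) : Nonempty (IsTerminal (H.obj T)) := by
  have key (Y : D) : ∃ f : Y ⟶ H.obj T, ∀ g : Y ⟶ H.obj T, g = f := by
    obtain ⟨X, hX, ⟨i⟩⟩ := hH.exists_iso Y
    refine ⟨i.inv ≫ H.map (hT.from X), fun g => ?_⟩
    obtain ⟨g₀, hg₀⟩ := (hH.bijective hX T).2 (i.hom ≫ g)
    dsimp only at hg₀
    rw [Iso.eq_inv_comp, ← hg₀, hT.hom_ext g₀]
  choose f hf using key
  exact ⟨IsTerminal.ofUniqueHom f hf⟩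

lemma preservesFiniteLimits [HasFiniteLimits C] : PreservesFiniteLimits H :=
  preservesFiniteLimits_of_isPullback H terminalIsTerminal
    (hH.isTerminal_obj terminalIsTerminal).some fun _ _ _ _ _ _ _ _ sq => hH.isPullback_map sq

/-- Since V is a sieve, Y in V forces every test object of a cone into V, where H is bijective on
morphisms. -/
lemma isPullback_of_map {P X Y Z : C} {fst : P ⟶ X} {snd : P ⟶ Y} {f : X ⟶ Z} {g : Y ⟶ Z}
    (hY : V Y) (sq : IsPullback (H.map fst) (H.map snd) (H.map f) (H.map g)) :
    IsPullback fst snd f g := by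
  refine isPullback_of_existsUnique ((hH.bijective (hH.sieve snd hY) Z).1 ?_) fun T a b hab => ?_
  · simpa only [H.map_comp] using sq.w
  · have hT := hH.sieve b hY
    obtain ⟨z, hz⟩ := (hH.bijective hT P).2 (sq.lift (H.map a) (H.map b) (by
      rw [← H.map_comp, hab, H.map_comp]))
    dsimp only at hz
    refine ⟨z, ⟨(hH.bijective hT X).1 ?_, (hH.bijective hT Y).1 ?_⟩, fun z' h' =>
      (hH.bijective hT P).1 (sq.hom_ext ?_ ?_)⟩
    · dsimp only
      rw [H.map_comp, hz, sq.lift_fst]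
    · dsimp only
      rw [H.map_comp, hz, sq.lift_snd]
    · dsimp only
      rw [hz, sq.lift_fst, ← H.map_comp, h'.1]
    · dsimp only
      rw [hz, sq.lift_snd, ← H.map_comp, h'.2]

lemma exists_cospan {X Y Z : D} (f : X ⟶ Z) (g : Y ⟶ Z) :
    ∃ (X₀ Y₀ Z₀ : C) (f₀ : X₀ ⟶ Z₀) (g₀ : Y₀ ⟶ Z₀) (i : H.obj X₀ ≅ X) (j : H.obj Y₀ ≅ Y)
      (k : H.obj Z₀ ≅ Z), H.map f₀ ≫ k.hom = i.hom ≫ f ∧ H.map g₀ ≫ k.hom = j.hom ≫ g := by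
  obtain ⟨X₀, hX, ⟨i⟩⟩ := hH.exists_iso X
  obtain ⟨Y₀, hY, ⟨j⟩⟩ := hH.exists_iso Y
  obtain ⟨Z₀, -, ⟨k⟩⟩ := hH.exists_iso Z
  obtain ⟨f₀, hf⟩ := (hH.bijective hX Z₀).2 (i.hom ≫ f ≫ k.inv)
  obtain ⟨g₀, hg⟩ := (hH.bijective hY Z₀).2 (j.hom ≫ g ≫ k.inv)
  dsimp only at hf hg
  exact ⟨X₀, Y₀, Z₀, f₀, g₀, i, j, k, by simp [hf], by simp [hg]⟩

lemma hasFiniteLimits [HasFiniteLimits C] : HasFiniteLimits D := by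
  have : HasTerminal D := (hH.isTerminal_obj terminalIsTerminal).some.hasTerminal
  have {X Y Z : D} {f : X ⟶ Z} {g : Y ⟶ Z} : HasLimit (cospan f g) := by
    obtain ⟨X₀, Y₀, Z₀, f₀, g₀, i, j, k, hf, hg⟩ := hH.exists_cospan f g
    exact ((hH.isPullback_map (IsPullback.of_hasPullback f₀ g₀)).of_iso
      (fst' := H.map (pullback.fst f₀ g₀) ≫ i.hom) (snd' := H.map (pullback.snd f₀ g₀) ≫ j.hom)
      (Iso.refl _) i j k (Category.id_comp _).symm (Category.id_comp _).symm hf hg).hasPullback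
  have : HasPullbacks D := hasPullbacks_of_hasLimit_cospan D
  exact hasFiniteLimits_of_hasTerminal_and_pullbacks

/-- With B and R moved into V, a relation between B and A comes from one in C and is classified
there. Uniqueness reflects the pullback square back to C. -/
lemma isPowerObject_map {P E A : C} {p : E ⟶ P} {a : E ⟶ A} (h : IsPowerObject p a) :
    IsPowerObject (H.map p) (H.map a) where
  jointlyMono T x y e₁ e₂ := by
    obtain ⟨T₀, hT, ⟨i⟩⟩ := hH.exists_iso T
    obtain ⟨x₀, hx⟩ := (hH.bijective hT E).2 (i.hom ≫ x)
    obtain ⟨y₀, hy⟩ := (hH.bijective hT E).2 (i.hom ≫ y)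
    dsimp only at hx hy
    rw [← cancel_epi i.hom, ← hx, ← hy]
    refine congrArg _ (h.jointlyMono _ _ ((hH.bijective hT P).1 ?_) ((hH.bijective hT A).1 ?_))
    · simp only [H.map_comp, hx, hy, Category.assoc, e₁]
    · simp only [H.map_comp, hx, hy, Category.assoc, e₂]
  existsUnique B R r s hrs := by
    obtain ⟨B₀, hB, ⟨β⟩⟩ := hH.exists_iso B
    obtain ⟨R₀, hR, ⟨ρ⟩⟩ := hH.exists_iso R
    obtain ⟨r₀, hr⟩ := (hH.bijective hR B₀).2 (ρ.hom ≫ r ≫ β.inv)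
    obtain ⟨s₀, hs⟩ := (hH.bijective hR A).2 (ρ.hom ≫ s)
    dsimp only at hr hs
    obtain ⟨k₀, ⟨q₀, hq, sq⟩, hu⟩ := h.existsUnique r₀ s₀ fun Z x y e₁ e₂ => by
      refine (hH.bijective (hH.sieve x hR) R₀).1 ((cancel_mono ρ.hom).1 (hrs _ _ ?_ ?_))
      · have := congrArg H.map e₁
        rw [H.map_comp, H.map_comp, hr] at this
        simpa only [Category.assoc, Iso.inv_hom_id, Category.comp_id] using this =≫ β.hom
      · have := congrArg H.map e₂
        rw [H.map_comp, H.map_comp, hs] at this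
        simpa only [Category.assoc] using this
    have hr' : H.map r₀ ≫ β.hom = ρ.hom ≫ r := by simp [hr]
    refine ⟨β.inv ≫ H.map k₀, ⟨ρ.inv ≫ H.map q₀, ?_, ?_⟩, ?_⟩
    · rw [Category.assoc, ← H.map_comp, hq, hs, ρ.inv_hom_id_assoc]
    · exact (hH.isPullback_map sq).of_iso ρ (Iso.refl _) β (Iso.refl _) (by simp) hr' (by simp)
        (by simp)
    · rintro k ⟨q, hq', sq'⟩
      obtain ⟨k₁, hk₁⟩ := (hH.bijective hB P).2 (β.hom ≫ k)
      obtain ⟨q₁, hq₁⟩ := (hH.bijective hR E).2 (ρ.hom ≫ q)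
      dsimp only at hk₁ hq₁
      rw [Iso.eq_inv_comp, ← hk₁]
      refine congrArg _ (hu k₁ ⟨q₁, (hH.bijective hR A).1 ?_, hH.isPullback_of_map hB ?_⟩)
      · dsimp only
        rw [H.map_comp, hq₁, Category.assoc, hq', hs]
      · refine sq'.of_iso ρ.symm (Iso.refl _) β.symm (Iso.refl _) ?_ ?_ (by simp) ?_
        · simp [hq₁]
        · simp [hr]
        · simp [hk₁]

lemma isElementaryTopos [IsElementaryTopos C] : IsElementaryTopos D where
  toHasFiniteLimits := hH.hasFiniteLimits
  exists_powerObject A := by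
    obtain ⟨A₀, -, ⟨i⟩⟩ := hH.exists_iso A
    obtain ⟨P, E, p, a, h⟩ := IsElementaryTopos.exists_powerObject A₀
    exact ⟨H.obj P, H.obj E, H.map p, H.map a ≫ i.hom, (hH.isPowerObject_map h).of_iso (Iso.refl _)
      (Iso.refl _) i (by simp) (by simp)⟩

lemma isLogical [HasFiniteLimits C] : IsLogical H where
  preservesFiniteLimits := hH.preservesFiniteLimits
  map_powerObject _ _ _ _ _ h := hH.isPowerObject_map h

/-- A functor on `D` is logical if its composition with `H` is. -/
lemma isLogical_of_comp [IsElementaryTopos C] {E : Type u''} [Category.{v''} E] {G : D ⥤ E}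
    (hG : IsLogical (H ⋙ G)) : IsLogical G where
  preservesFiniteLimits := by
    have := hH.hasFiniteLimits
    have := hG.preservesFiniteLimits
    refine preservesFiniteLimits_of_isPullback G (hH.isTerminal_obj terminalIsTerminal).some
      (terminalIsTerminal.isTerminalObj (H ⋙ G) _) fun P X Y Z fst snd f g sq => ?_
    obtain ⟨X₀, Y₀, Z₀, f₀, g₀, i, j, k, hf, hg⟩ := hH.exists_cospan f g
    have sq₀ := IsPullback.of_hasPullback f₀ g₀
    have sq₁ := (hH.isPullback_map sq₀).of_iso
      (fst' := H.map (pullback.fst f₀ g₀) ≫ i.hom) (snd' := H.map (pullback.snd f₀ g₀) ≫ j.hom)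
      (Iso.refl _) i j k (Category.id_comp _).symm (Category.id_comp _).symm hf hg
    refine (sq₀.map (H ⋙ G)).of_iso (G.mapIso (sq₁.isoIsPullback _ _ sq)) (G.mapIso i) (G.mapIso j)
      (G.mapIso k) ?_ ?_ ?_ ?_
    · rw [Functor.comp_map, Functor.mapIso_hom, Functor.mapIso_hom, ← G.map_comp, ← G.map_comp,
        IsPullback.isoIsPullback_hom_fst]
    · rw [Functor.comp_map, Functor.mapIso_hom, Functor.mapIso_hom, ← G.map_comp, ← G.map_comp,
        IsPullback.isoIsPullback_hom_snd]
    · rw [Functor.comp_map, Functor.mapIso_hom, Functor.mapIso_hom, ← G.map_comp, ← G.map_comp, hf]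
    · rw [Functor.comp_map, Functor.mapIso_hom, Functor.mapIso_hom, ← G.map_comp, ← G.map_comp, hg]
  map_powerObject P E A p a h := by
    obtain ⟨A₀, -, ⟨i⟩⟩ := hH.exists_iso A
    obtain ⟨P₀, E₀, p₀, a₀, h₀⟩ := IsElementaryTopos.exists_powerObject A₀
    -- Power objects are unique up to isomorphism, so the given one may be replaced by an image from
    -- C.
    obtain ⟨eP, eE, e₁, e₂⟩ := ((hH.isPowerObject_map h₀).of_iso (a' := H.map a₀ ≫ i.hom)
      (p' := H.map p₀) (Iso.refl _) (Iso.refl _) i (by simp) (by simp)).exists_iso h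
    refine (hG.map_powerObject _ _ h₀).of_iso (G.mapIso eP) (G.mapIso eE) (G.mapIso i) ?_ ?_
    · rw [Functor.comp_map, Functor.mapIso_hom, Functor.mapIso_hom, ← G.map_comp, ← G.map_comp, e₁]
    · rw [Functor.comp_map, Functor.mapIso_hom, Functor.mapIso_hom, ← G.map_comp, ← G.map_comp, e₂]

end IsLocalQuotient

end LocalQuotient

/-! ### The Boolean topos Bool(T) and its universal property -/

section Booleanization

variable {C : Type u} [Category.{v} C] [IsElementaryTopos C]

variable (C) in
-- V is the sieve of objects admitting a morphism to U. Every object A is reached because the mono U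
-- × A → A lies in B(T) and is therefore inverted.
lemma exists_isLocalQuotient :
    ∃ V : C → Prop, IsLocalQuotient (quotientFunctor (boolClass C)) V := by
  obtain ⟨S, Ω, b, U, hb, hU, e⟩ := exists_openClass_eq_boolClass C
  have key (A : C) : IsIso ((quotientFunctor (boolClass C)).map (prod.snd : U ⨯ A ⟶ A)) := by
    have : Mono (prod.snd : U ⨯ A ⟶ A) := ⟨fun x y h => prod.hom_ext (hU.hom_eq _ _) h⟩
    have h : openClass U (prod.snd : U ⨯ A ⟶ A) := openClass_of_liftsThru fun Z x s =>
      ⟨prod.lift x s, prod.lift_snd _ _⟩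
    exact isIso_quotientFunctor_map (boolClass C) _ (e.le _ h)
  exact ⟨fun X => Nonempty (X ⟶ U), fun Z X f ⟨x⟩ => ⟨f ≫ x⟩,
    fun X ⟨x⟩ Y => quotientFunctor_map_bijective e.ge x Y,
    fun Y => ⟨U ⨯ Y.obj, ⟨prod.fst⟩, ⟨@asIso _ _ _ _ _ (key Y.obj)⟩⟩⟩

variable (C) in
lemma isLogical_quotientFunctor : IsLogical (quotientFunctor (boolClass C)) :=
  (exists_isLocalQuotient C).choose_spec.isLogical

variable (C) in
lemma isBooleanTopos_mapSpan : IsBooleanTopos (MapSpan (boolClass C)) := by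
  have : IsElementaryTopos (MapSpan (boolClass C)) :=
    (exists_isLocalQuotient C).choose_spec.isElementaryTopos
  obtain ⟨S, Ω, b, hb⟩ := exists_isTrueFalse C
  have := hb.mono
  exact ⟨⟨_, _, _, hb.map (isLogical_quotientFunctor C),
    isIso_quotientFunctor_map _ b fun W _ hW => hW b hb⟩⟩

lemma quotientFunctor_comp_mapSpanFunctor {D : Type u'} [Category.{v'} D] [IsElementaryTopos D]
    (F : C ⥤ D) [PreservesFiniteLimits F] {W : MorphismProperty C} {W' : MorphismProperty D}
    [IsLogicalClass W] [IsLogicalClass W'] (hF : W ≤ W'.inverseImage F) :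
    quotientFunctor W ⋙ mapSpanFunctor F hF = F ⋙ quotientFunctor W' :=
  CategoryTheory.Functor.hext (fun _ => rfl) fun A _ f => heq_of_eq <|
    WideSubcategory.hom_ext _
      (congrArg (fun a => SpanHom.mk W' (Sp.mk a (F.map f))) (F.map_id A))

lemma isLogical_mapSpanFunctor {D : Type u'} [Category.{v'} D] [IsElementaryTopos D]
    {F : C ⥤ D} (hF : IsLogical F) [PreservesFiniteLimits F]
    (hW : boolClass C ≤ (boolClass D).inverseImage F) : IsLogical (mapSpanFunctor F hW) := by
  refine (exists_isLocalQuotient C).choose_spec.isLogical_of_comp ?_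
  rw [quotientFunctor_comp_mapSpanFunctor]
  exact hF.comp (isLogical_quotientFunctor D)

/-- Given φ out of η(A), choose X over U with i : η(X) ≅ η(A). Both i and i ≫ φ are images of
morphisms of T, so φ = η(f)⁻¹ η(g) is determined by η. -/
lemma functor_eq_of_quotientFunctor_comp_eq {E : Type u''} [Category.{v''} E]
    {G G' : MapSpan (boolClass C) ⥤ E}
    (h : quotientFunctor (boolClass C) ⋙ G = quotientFunctor (boolClass C) ⋙ G') : G = G' := by
  obtain ⟨V, hV⟩ := exists_isLocalQuotient C
  have key (A B : C) (φ : (quotientFunctor (boolClass C)).obj A ⟶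
      (quotientFunctor (boolClass C)).obj B) :
      G.map φ = eqToHom (Functor.congr_obj h A) ≫ G'.map φ ≫
        eqToHom (Functor.congr_obj h B).symm := by
    obtain ⟨X, hX, ⟨i⟩⟩ := hV.exists_iso ((quotientFunctor (boolClass C)).obj A)
    obtain ⟨f, hf⟩ := (hV.bijective hX A).2 i.hom
    obtain ⟨g, hg⟩ := (hV.bijective hX B).2 (i.hom ≫ φ)
    have ef := Functor.congr_hom h f
    have eg := Functor.congr_hom h g
    dsimp only at hf hg
    rw [Functor.comp_map, Functor.comp_map, hf] at ef
    rw [Functor.comp_map, Functor.comp_map, hg] at eg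
    rw [← cancel_epi (G.map i.hom), ← G.map_comp, eg, ef]
    simp
  exact CategoryTheory.Functor.ext (fun A => Functor.congr_obj h A.obj)
    fun A B φ => key A.obj B.obj φ

/-- Since b is invertible, every truth value lifts through it, so every object admits a morphism to
U. -/
lemma quotientFunctor_map_bijective_of_isBooleanTopos {C : Type u} [Category.{v} C]
    [IsBooleanTopos C] (A B : C) :
    Function.Bijective (fun f : A ⟶ B => (quotientFunctor (boolClass C)).map f) := by
  obtain ⟨S, Ω, b, hb, _⟩ := IsBooleanTopos.exists_isIso (C := C)
  obtain ⟨U, hU⟩ := exists_isBoolLocus b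
  obtain ⟨x⟩ := hU.nonempty_iff (Z := A) |>.2 fun Z y p => ⟨p ≫ inv b, by simp⟩
  exact quotientFunctor_map_bijective (hU.openClass_eq_boolClass hb).ge x B

/-- The inverse of the quotient functor, if it is fully faithful. -/
noncomputable def quotientInverse {W : MorphismProperty C} [IsLogicalClass W]
    (h : ∀ A B : C, Function.Bijective (fun f : A ⟶ B => (quotientFunctor W).map f)) :
    MapSpan W ⥤ C where
  obj A := A.obj
  map {A B} φ := ((h A.obj B.obj).2 φ).choose
  map_id A := (h A.obj A.obj).1 <|
    ((h A.obj A.obj).2 (𝟙 A)).choose_spec.trans ((quotientFunctor W).map_id A.obj).symm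
  map_comp {A B D} φ ψ := (h A.obj D.obj).1 <|
    ((h A.obj D.obj).2 (φ ≫ ψ)).choose_spec.trans <|
      (congrArg₂ (· ≫ ·) ((h A.obj B.obj).2 φ).choose_spec
        ((h B.obj D.obj).2 ψ).choose_spec).symm.trans ((quotientFunctor W).map_comp _ _).symm

lemma quotientFunctor_comp_quotientInverse {W : MorphismProperty C} [IsLogicalClass W]
    (h : ∀ A B : C, Function.Bijective (fun f : A ⟶ B => (quotientFunctor W).map f)) :
    quotientFunctor W ⋙ quotientInverse h = 𝟭 C :=
  CategoryTheory.Functor.hext (fun _ => rfl) fun A B f => heq_of_eq <|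
    (h A B).1 ((h A B).2 ((quotientFunctor W).map f)).choose_spec

lemma isLogical_quotientInverse
    (h : ∀ A B : C, Function.Bijective (fun f : A ⟶ B => (quotientFunctor (boolClass C)).map f)) :
    IsLogical (quotientInverse h) := by
  refine (exists_isLocalQuotient C).choose_spec.isLogical_of_comp ?_
  rw [quotientFunctor_comp_quotientInverse]
  exact IsLogical.id

end Booleanization

/-! ### The adjunction -/

lemma boolUnit_comp_bijective (T : Topos.{w, u}) (B : BoolTopos.{w, u})
    (hB : IsBooleanTopos (Booleanization T))
    (hη : IsLogical (quotientFunctor (boolClass T.carrier))) :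
    Function.Bijective (fun G : boolObj T hB ⟶ B => boolUnit T hB hη ≫ boolInclusion.map G) := by
  constructor
  · intro G G' h
    exact ObjectProperty.hom_ext _ (Topos.Hom.ext
      (functor_eq_of_quotientFunctor_comp_eq (congrArg Topos.Hom.functor h)))
  · intro F
    have := B.property
    have : IsBooleanTopos B.obj.carrier := this
    have h := quotientFunctor_map_bijective_of_isBooleanTopos (C := B.obj.carrier)
    have hW := boolClass_le_inverseImage F.isLogical
    -- The extension of F is Bool(F) followed by the inverse of η at the Boolean topos B.
    refine ⟨ObjectProperty.homMk ⟨mapSpanFunctor F.functor hW ⋙ quotientInverse h,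
      (isLogical_mapSpanFunctor F.isLogical hW).comp (isLogical_quotientInverse h)⟩,
      Topos.Hom.ext ?_⟩
    change quotientFunctor _ ⋙ mapSpanFunctor F.functor hW ⋙ quotientInverse h = F.functor
    rw [← Functor.assoc, quotientFunctor_comp_mapSpanFunctor, Functor.assoc,
      quotientFunctor_comp_quotientInverse, Functor.comp_id]

end ToposBool

theorem mainTheorem1 :
    ∃ (hB : ∀ T : Topos.{w, u}, IsBooleanTopos (Booleanization T))
      (hη : ∀ T : Topos.{w, u}, IsLogical (quotientFunctor (boolClass T.carrier)))
      (hW : ∀ ⦃T T' : Topos.{w, u}⦄ (F : T ⟶ T'),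
        boolClass T.carrier ≤ (boolClass T'.carrier).inverseImage F.functor)
      (hL : ∀ ⦃T T' : Topos.{w, u}⦄ (F : T ⟶ T'), IsLogical (mapSpanFunctor F.functor (hW F)))
      (adj : boolFunctor hB hW hL ⊣ boolInclusion.{w, u}),
      boolInclusion.{w, u}.Full ∧ boolInclusion.{w, u}.Faithful ∧
        ∀ T : Topos.{w, u}, adj.unit.app T = boolUnit T (hB T) (hη T) := by
  have hB (T : Topos.{w, u}) : IsBooleanTopos (Booleanization T) :=
    isBooleanTopos_mapSpan T.carrier
  have hη (T : Topos.{w, u}) : IsLogical (quotientFunctor (boolClass T.carrier)) :=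
    isLogical_quotientFunctor T.carrier
  have hW ⦃T T' : Topos.{w, u}⦄ (F : T ⟶ T') :
      boolClass T.carrier ≤ (boolClass T'.carrier).inverseImage F.functor :=
    boolClass_le_inverseImage F.isLogical
  have hL ⦃T T' : Topos.{w, u}⦄ (F : T ⟶ T') : IsLogical (mapSpanFunctor F.functor (hW F)) :=
    isLogical_mapSpanFunctor F.isLogical (hW F)
  have naturality ⦃T T' : Topos.{w, u}⦄ (F : T ⟶ T') :
      boolUnit T (hB T) (hη T) ≫ boolInclusion.map ((boolFunctor hB hW hL).map F) =
        F ≫ boolUnit T' (hB T') (hη T') :=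
    Topos.Hom.ext (quotientFunctor_comp_mapSpanFunctor F.functor (hW F))
  let e (T : Topos.{w, u}) (B : BoolTopos.{w, u}) :
      ((boolFunctor hB hW hL).obj T ⟶ B) ≃ (T ⟶ boolInclusion.obj B) :=
    Equiv.ofBijective _ (boolUnit_comp_bijective T B (hB T) (hη T))
  let adj : boolFunctor hB hW hL ⊣ boolInclusion.{w, u} := Adjunction.mkOfHomEquiv
    { homEquiv := e
      homEquiv_naturality_left_symm := fun {T T' B} F G => by
        obtain ⟨G, rfl⟩ := (e T' B).surjective G
        rw [Equiv.symm_apply_eq, Equiv.symm_apply_apply]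
        change F ≫ boolUnit T' (hB T') (hη T') ≫ boolInclusion.map G =
          boolUnit T (hB T) (hη T) ≫ boolInclusion.map ((boolFunctor hB hW hL).map F ≫ G)
        exact (Category.assoc _ _ _).symm.trans <|
          (congrArg (· ≫ boolInclusion.map G) (naturality F).symm).trans <|
          (Category.assoc _ _ _).trans <|
          congrArg (boolUnit T (hB T) (hη T) ≫ ·) (boolInclusion.map_comp _ G).symm
      homEquiv_naturality_right := fun {T B B'} G G' => by
        change boolUnit T (hB T) (hη T) ≫ boolInclusion.map (G ≫ G') =
          (boolUnit T (hB T) (hη T) ≫ boolInclusion.map G) ≫ boolInclusion.map G'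
        exact (congrArg (boolUnit T (hB T) (hη T) ≫ ·) (boolInclusion.map_comp G G')).trans
          (Category.assoc _ _ _).symm }
  refine ⟨hB, hη, hW, hL, adj, inferInstance, inferInstance, fun T => ?_⟩
  have h : adj.unit.app T = e T _ (𝟙 _) := by simp [adj]
  rw [h]
  change boolUnit T (hB T) (hη T) ≫ boolInclusion.map (𝟙 _) = _
  exact (congrArg (boolUnit T (hB T) (hη T) ≫ ·) (boolInclusion.map_id _)).trans
    (Category.comp_id _)
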